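/- Let $G$ be a finite graph, possibly with loops and multiple edges, with vertex set $V(G)$, edge set $E(G)$ and $n=|V(G)|$. Identify spanning subgraphs of $G$ with subsets $S\subseteq E(G)$, let $\mathcal S(G)=2^{E(G)}$, let $\kappa(S)$ be the number of connected components of $(V(G),S)$, and let $\kappa=\kappa(E(G))$. Fix a total order $<$ on $E(G)$, a reference orientation, which gives each edge $e$ a positive direction $e^+$ and the opposite direction $e^-$, and arbitrary sign labels $\sigma_u,\sigma_b\colon E(G)\to\{+,-\}$. *Activities of subgraphs.* A cut of $G$ is a minimal nonempty set $C$ of edges with $\kappa(E(G)\setminus C)>\kappa$; a cycle is a minimal nonempty set of edges of which no cut contains exactly one element. For $S\in\mathcal S(G)$ let $\hat I(S)$ be the set of edges $e$ that are the minimum of some cut disjoint from $S\setminus\{e\}$, and $\hat L(S)$ the set of edges $e$ that are the minimum of some cycle contained in $S\cup\{e\}$. *Fourientations.* A fourientation is an arbitrary subset $O$ of $\{e^+,e^-: e\in E(G)\}$; the set of all fourientations is $\mathcal O^4(G)$. Let $O^u$, $O^b$, $O^+$, $O^-$ be the sets of edges $e$ for which $O\cap\{e^+,e^-\}$ is $\varnothing$,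 $\{e^+,e^-\}$, $\{e^+\}$, $\{e^-\}$ respectively, and $O^o=O^+\cup O^-$. A directed cut (directed cycle) is a cut (cycle) with one of its two consistent orientations. A potential cut of $O$ is a directed cut such that $O$ contains the opposite of none of its directed edges; a potential cycle of $O$ is a directed cycle all of whose directed edges belong to $O$. Put - $I^o(O)=\{e\in O^o: e$ is the minimum edge of some potential cut of $O\}$, - $L^o(O)=\{e\in O^o: e$ is the minimum edge of some potential cycle of $O\}$, - $I^u(O)=\{e\in O^u: e$ is the minimum edge of some potential cut of $O\cup\{e^{\sigma_u(e)}\}\}$, - $L^b(O)=\{e\in O^b: e$ is the minimum edge of some potential cycle of $O\setminus\{e^{\sigma_b(e)}\}\}$. For a map $\varphi\colon\mathcal O^4(G)\to\mathcal S(G)$ put $I(O)=\hat I(\varphi(O))$ and $L(O)=\hat L(\varphi(O))$, and consider the following conditions, required for all $O\in\mathcal O^4(G)$: 1. $\varphi$ is a $2^{|E(G)|}$-to-one surjection, and $O\mapsto(\varphi(O),O^o)$ is a bijection $\mathcal O^4(G)\to\mathcal S(G)\times\mathcal S(G)$; 2. $O^u\cap\varphi(O)=\varnothing$ and $O^b\subseteq\varphi(O)$;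 3. $I(O)\cap O^o=I^o(O)$, $I(O)\cap O^u=I^u(O)$, $L(O)\cap O^o=L^o(O)$ and $L(O)\cap O^b=L^b(O)$; 4. $I(O)\cap O^+\subseteq\varphi(O)$, $I(O)\cap O^-\cap\varphi(O)=\varnothing$, $L(O)\cap O^-\subseteq\varphi(O)$ and $L(O)\cap O^+\cap\varphi(O)=\varnothing$; 5. if $O^o=\varnothing$, then $I(O)=\hat I(O^b)$ and $L(O)=\hat L(O^b)$. **Theorem.** A map $\varphi$ satisfying 1–5 exists. Moreover, for every such $\varphi$, every commutative ring $R$, all functions $k_1,k_2,l,m\colon E(G)\to R$ and all $w,z\in R$, $$N_G\bigl(k_1(e)+m(e),\,k_2(e)+l(e);\,1+w,\,1+z\bigr)=\sum_{O\in\mathcal O^4(G)}\ \prod_{e\in O^o\cap\varphi(O)}k_1(e)\prod_{e\in O^o\setminus\varphi(O)}k_2(e)\prod_{e\in O^u}l(e)\prod_{e\in O^b}m(e)\cdot w^{|I^u(O)\cup I^-(O)|}\,z^{|L^b(O)\cup L^-(O)|},$$ where $I^u(O)=I(O)\cap O^u$, $I^-(O)=I(O)\cap O^-$, $L^b(O)=L(O)\cap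 O^b$, $L^-(O)=L(O)\cap O^-$, and $N_G$ is the normal function $$N_G(\alpha(e),\beta(e);u,v)=\sum_{S\in\mathcal S(G)}\Bigl(\prod_{e\in S}\alpha(e)\Bigr)\Bigl(\prod_{e\notin S}\beta(e)\Bigr)(u-1)^{\kappa(S)-\kappa}(v-1)^{|S|-n+\kappa(S)}.$$ -/

import Mathlib

open scoped Graph

namespace Fourientation

noncomputable section

section Subgraphs

variable {α β : Type*} (G : Graph α β)

/-- A spanning subgraph `(V(G), S)` of `G`, identified with its set `S` of edges. -/
abbrev SpanningSubgraph := Finset E(G)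

variable {G}

/-- `κ(S)`: the number of connected components of the spanning subgraph `(V(G), S)`, that is, the
number of classes of the equivalence relation on `V(G)` generated by being joined by an edge
of `S`. -/
def numComponents (S : SpanningSubgraph G) : ℕ :=
  Nat.card (Quot fun x y : V(G) => ∃ e ∈ S, G.IsLink (e : β) (x : α) (y : α))

variable [Fintype E(G)] [LinearOrder E(G)]

/-- The edge sets of cuts: minimal among the nonempty `S` with `κ(E(G) \ S) > κ(G)`. -/
def IsCut (C : SpanningSubgraph G) : Prop :=
  Minimal (fun S : SpanningSubgraph G =>
    S.Nonempty ∧ numComponents (Finset.univ : SpanningSubgraph G) < numComponents Sᶜ) C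

/-- The edge sets of cycles: minimal among the nonempty `S` such that no cut includes precisely
one element of `S`. -/
def IsCycle (C : SpanningSubgraph G) : Prop :=
  Minimal (fun S : SpanningSubgraph G =>
    S.Nonempty ∧ ∀ D : SpanningSubgraph G, IsCut D → (D ∩ S).card ≠ 1) C

open Classical in
/-- The generalized cut activity `Î(S)`: the edges `e` that are the minimum edge of some cut
disjoint from `S \ {e}`. -/
def cutActive (S : SpanningSubgraph G) : SpanningSubgraph G :=
  Finset.univ.filter fun e =>
    ∃ C : SpanningSubgraph G, IsCut C ∧ Disjoint C (S.erase e) ∧ IsLeast (C : Set E(G)) e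

open Classical in
/-- The generalized cycle activity `L̂(S)`: the edges `e` that are the minimum edge of some cycle
contained in `S ∪ {e}`. -/
def cycleActive (S : SpanningSubgraph G) : SpanningSubgraph G :=
  Finset.univ.filter fun e =>
    ∃ C : SpanningSubgraph G, IsCycle C ∧ C ⊆ insert e S ∧ IsLeast (C : Set E(G)) e

/-- Zaslavsky's normal function `N_G(a, b; u, v)`. Both exponents are differences of natural
numbers that are never negative: `κ(S) ≥ κ(G)` and `|S| + κ(S) ≥ |V(G)|`. -/
def normalFunction {R : Type*} [CommRing R] (a b : E(G) → R) (u v : R) : R :=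
  ∑ S : SpanningSubgraph G, (∏ e ∈ S, a e) * (∏ e ∈ Sᶜ, b e) *
    (u - 1) ^ (numComponents S - numComponents (Finset.univ : SpanningSubgraph G)) *
    (v - 1) ^ (S.card + numComponents S - Nat.card V(G))

end Subgraphs

section Orientations

variable {α β : Type*} (G : Graph α β)

/-- A reference orientation: the positive direction `e⁺` of the edge `e` runs from `tail e`
to `head e`. -/
structure RefOrientation where
  tail : E(G) → V(G)
  head : E(G) → V(G)
  isLink : ∀ e : E(G), G.IsLink (e : β) (tail e : α) (head e : α)

/-- The set `{e⁺, e⁻ : e ∈ E(G)}` of signed edges: `(e, true)` is `e⁺` and `(e, false)` is `e⁻`. -/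
abbrev SignedEdge := E(G) × Bool

/-- A fourientation: an arbitrary set of signed edges. -/
abbrev Four := Finset (SignedEdge G)

variable {G}

/-- The other direction of the same edge. -/
def SignedEdge.rev (d : SignedEdge G) : SignedEdge G := (d.1, !d.2)

/-- The vertex at which a signed edge starts. -/
def RefOrientation.src (ref : RefOrientation G) (d : SignedEdge G) : V(G) :=
  if d.2 then ref.tail d.1 else ref.head d.1

/-- The vertex at which a signed edge ends. -/
def RefOrientation.dst (ref : RefOrientation G) (d : SignedEdge G) : V(G) :=
  if d.2 then ref.head d.1 else ref.tail d.1

variable [Fintype E(G)] [LinearOrder E(G)]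

/-- `O⁺`: the edges that are simply oriented in agreement with the reference orientation. -/
def posEdges (O : Four G) : SpanningSubgraph G :=
  Finset.univ.filter fun e => (e, true) ∈ O ∧ (e, false) ∉ O

/-- `O⁻`: the edges that are simply oriented in disagreement with the reference orientation. -/
def negEdges (O : Four G) : SpanningSubgraph G :=
  Finset.univ.filter fun e => (e, false) ∈ O ∧ (e, true) ∉ O

/-- `Oᵒ`: the simply oriented edges. -/
def orientedEdges (O : Four G) : SpanningSubgraph G := posEdges O ∪ negEdges O

/-- `Oᵘ`: the unoriented edges. -/
def unorientedEdges (O : Four G) : SpanningSubgraph G :=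
  Finset.univ.filter fun e => (e, true) ∉ O ∧ (e, false) ∉ O

/-- `Oᵇ`: the bioriented edges. -/
def biorientedEdges (O : Four G) : SpanningSubgraph G :=
  Finset.univ.filter fun e => (e, true) ∈ O ∧ (e, false) ∈ O

/-- The set of edges that occur in a set of signed edges. -/
def edges (D : Finset (SignedEdge G)) : SpanningSubgraph G := D.image Prod.fst

/-- A directed cut: a cut that consists of the edges between `X` and its complement, all of them
directed out of `X`. (Exchanging `X` and its complement gives the opposite orientation.) -/
def IsDirectedCut (ref : RefOrientation G) (D : Finset (SignedEdge G)) : Prop :=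
  IsCut (edges D) ∧
    ∃ X : Set V(G), ∀ d : SignedEdge G, d ∈ D ↔ ref.src d ∈ X ∧ ref.dst d ∉ X

/-- A directed cycle: a cycle whose edges, each used once and in one direction, can be arranged
in a cyclic sequence in which each of them ends where the next one starts. -/
def IsDirectedCycle (ref : RefOrientation G) (D : Finset (SignedEdge G)) : Prop :=
  IsCycle (edges D) ∧
    ∃ c : Cycle (SignedEdge G), (c.map Prod.fst).Nodup ∧ c.toFinset = D ∧
      c.Chain fun d d' => ref.dst d = ref.src d'

/-- A potential cut of `O`: a directed cut none of whose edges has its opposite direction in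
`O`. -/
def IsPotentialCut (ref : RefOrientation G) (O : Four G) (D : Finset (SignedEdge G)) : Prop :=
  IsDirectedCut ref D ∧ ∀ d ∈ D, d.rev ∉ O

/-- A potential cycle of `O`: a directed cycle all of whose directed edges belong to `O`. -/
def IsPotentialCycle (ref : RefOrientation G) (O : Four G) (D : Finset (SignedEdge G)) : Prop :=
  IsDirectedCycle ref D ∧ D ⊆ O

/-- `e` is the minimum edge of some potential cut of `O`. -/
def IsMinOfPotentialCut (ref : RefOrientation G) (O : Four G) (e : E(G)) : Prop :=
  ∃ D, IsPotentialCut ref O D ∧ IsLeast (edges D : Set E(G)) e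

/-- `e` is the minimum edge of some potential cycle of `O`. -/
def IsMinOfPotentialCycle (ref : RefOrientation G) (O : Four G) (e : E(G)) : Prop :=
  ∃ D, IsPotentialCycle ref O D ∧ IsLeast (edges D : Set E(G)) e

open Classical in
/-- The intrinsic set `Iᵒ(O)`. -/
def orientedCutActive (ref : RefOrientation G) (O : Four G) : SpanningSubgraph G :=
  (orientedEdges O).filter fun e => IsMinOfPotentialCut ref O e

open Classical in
/-- The intrinsic set `Lᵒ(O)`. -/
def orientedCycleActive (ref : RefOrientation G) (O : Four G) : SpanningSubgraph G :=
  (orientedEdges O).filter fun e => IsMinOfPotentialCycle ref O e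

open Classical in
/-- The intrinsic set `Iᵘ(O)`, with respect to the sign labels `σu`. -/
def unorientedCutActive (ref : RefOrientation G) (σu : E(G) → Bool) (O : Four G) :
    SpanningSubgraph G :=
  (unorientedEdges O).filter fun e => IsMinOfPotentialCut ref (insert (e, σu e) O) e

open Classical in
/-- The intrinsic set `Lᵇ(O)`, with respect to the sign labels `σb`. -/
def biorientedCycleActive (ref : RefOrientation G) (σb : E(G) → Bool) (O : Four G) :
    SpanningSubgraph G :=
  (biorientedEdges O).filter fun e => IsMinOfPotentialCycle ref (O.erase (e, σb e)) e

/-- The cut activity `I(O) = Î(φ(O))` of fourientations that a map `φ` induces. -/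
def fourCutActive (φ : Four G → SpanningSubgraph G) (O : Four G) : SpanningSubgraph G :=
  cutActive (φ O)

/-- The cycle activity `L(O) = L̂(φ(O))` of fourientations that a map `φ` induces. -/
def fourCycleActive (φ : Four G → SpanningSubgraph G) (O : Four G) : SpanningSubgraph G :=
  cycleActive (φ O)

/-- The properties that are required of the map `φ` from fourientations to spanning subgraphs,
for the given edge order, reference orientation and sign labels. -/
structure IsActivityMap (ref : RefOrientation G) (σu σb : E(G) → Bool)
    (φ : Four G → SpanningSubgraph G) : Prop where
  card_fiber : ∀ S, (Finset.univ.filter fun O => φ O = S).card = 2 ^ Fintype.card E(G)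
  bijective : Function.Bijective fun O : Four G => (φ O, orientedEdges O)
  unoriented_disjoint : ∀ O, Disjoint (unorientedEdges O) (φ O)
  bioriented_subset : ∀ O, biorientedEdges O ⊆ φ O
  cut_oriented : ∀ O, fourCutActive φ O ∩ orientedEdges O = orientedCutActive ref O
  cut_unoriented : ∀ O, fourCutActive φ O ∩ unorientedEdges O = unorientedCutActive ref σu O
  cycle_oriented : ∀ O, fourCycleActive φ O ∩ orientedEdges O = orientedCycleActive ref O
  cycle_bioriented : ∀ O,
    fourCycleActive φ O ∩ biorientedEdges O = biorientedCycleActive ref σb O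
  cut_pos_subset : ∀ O, fourCutActive φ O ∩ posEdges O ⊆ φ O
  cut_neg_disjoint : ∀ O, Disjoint (fourCutActive φ O ∩ negEdges O) (φ O)
  cycle_neg_subset : ∀ O, fourCycleActive φ O ∩ negEdges O ⊆ φ O
  cycle_pos_disjoint : ∀ O, Disjoint (fourCycleActive φ O ∩ posEdges O) (φ O)
  cut_of_not_oriented : ∀ O, orientedEdges O = ∅ →
    fourCutActive φ O = cutActive (biorientedEdges O)
  cycle_of_not_oriented : ∀ O, orientedEdges O = ∅ →
    fourCycleActive φ O = cycleActive (biorientedEdges O)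

/-- The sum over all fourientations of the weight of `O` with respect to `φ`. -/
def fourientationSum {R : Type*} [CommRing R] (φ : Four G → SpanningSubgraph G)
    (k₁ k₂ l m : E(G) → R) (w z : R) : R :=
  ∑ O : Four G,
    (∏ e ∈ orientedEdges O ∩ φ O, k₁ e) * (∏ e ∈ orientedEdges O \ φ O, k₂ e) *
      (∏ e ∈ unorientedEdges O, l e) * (∏ e ∈ biorientedEdges O, m e) *
      w ^ (fourCutActive φ O ∩ unorientedEdges O ∪ fourCutActive φ O ∩ negEdges O).card *
      z ^ (fourCycleActive φ O ∩ biorientedEdges O ∪ fourCycleActive φ O ∩ negEdges O).card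

end Orientations

end

end Fourientation

namespace Fourientation

/-! ### Vertex boundaries, components and directed cuts -/

section Boundaries

variable {α β : Type*} {G : Graph α β}

/-! The map `φ` comes from scanning the edges from the greatest to the least and deciding for each
whether it is contracted (put into `S = φ O`) or deleted. Bioriented edges are contracted and
unoriented ones deleted; an oriented edge needs a rule. When `e` is reached, the state `R` of the
other edges is `O` below `e`, and above `e` both directions of the contracted edges and no direction
of the deleted ones (`belowAbove`). Potential cycles live in `R`, potential cuts in `coSet R`. The
rule must not change which edges below `e` are minima of potential cuts or cycles, and it must
contract exactly one of the two orientations of `e`.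

Such a rule exists by oriented matroid duality, for which `IsDualPair` records all that is needed:
orthogonality of directed cuts and cycles, and the painting lemma
`exists_isDirectedCycle_or_isDirectedCut`. These imply elimination. By elimination, at most one
direction of `e` matters for minima of cuts below `e`, and at most one for cycles
(`agree_or_agree`); by orthogonality the same direction never matters for both
(`agree_of_not_agree`). So one of the two possible rules is admissible (`good_or_good`). If `e` is
itself cut active or cycle active for `S`, both rules are admissible, which leaves room for the sign
conditions.

Activity of `e` depends only on the edges above it, so it can be read off either from `S` or from
the state when `e` is reached; invariance of the rule (`isMinIn_splice_iff`) carries the latter back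
to `O`. Conversely, `O` is recovered from `S` and its set of oriented edges by scanning upwards:
once `O` is known below `e`, so is the rule at `e`, and it tells the orientation
(`eq_of_contracts`).

For the expansion, κ(S) − κ = |Î(S) \ S| and |S| − n + κ(S) = |L̂(S) ∩ S| (`card_cutActive_sdiff`,
`card_cycleActive_inter`), by adding edges one at a time. Multiplying out the products over a second
set `T` of edges and reindexing pairs `(S, T)` by fourientations gives the formula for every
admissible `φ`, since the sign conditions identify the exponents of `w` and `z` with these two
cardinalities. -/

@[simp] theorem SignedEdge.rev_fst (d : SignedEdge G) : (SignedEdge.rev d).1 = d.1 := rfl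

@[simp] theorem SignedEdge.rev_rev (d : SignedEdge G) : SignedEdge.rev (SignedEdge.rev d) = d := by
  simp [SignedEdge.rev]

theorem SignedEdge.rev_ne (d : SignedEdge G) : SignedEdge.rev d ≠ d := by
  obtain ⟨e, _ | _⟩ := d <;> simp [SignedEdge.rev]

theorem SignedEdge.eq_or_eq_rev {d g : SignedEdge G} (h : g.1 = d.1) :
    g = d ∨ g = SignedEdge.rev d := by
  obtain ⟨e, _ | _⟩ := d <;> obtain ⟨e', _ | _⟩ := g <;> simp_all [SignedEdge.rev]

theorem SignedEdge.rev_eq_iff {d g : SignedEdge G} :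
    SignedEdge.rev d = g ↔ d = SignedEdge.rev g := by
  constructor <;> rintro rfl <;> simp

variable (ref : RefOrientation G)

@[simp] theorem RefOrientation.src_rev (d : SignedEdge G) :
    ref.src (SignedEdge.rev d) = ref.dst d := by
  obtain ⟨e, _ | _⟩ := d <;> simp [SignedEdge.rev, RefOrientation.src, RefOrientation.dst]

@[simp] theorem RefOrientation.dst_rev (d : SignedEdge G) :
    ref.dst (SignedEdge.rev d) = ref.src d := by
  obtain ⟨e, _ | _⟩ := d <;> simp [SignedEdge.rev, RefOrientation.src, RefOrientation.dst]

theorem RefOrientation.isLink_src_dst (d : SignedEdge G) :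
    G.IsLink (d.1 : β) (ref.src d : α) (ref.dst d : α) := by
  obtain ⟨e, _ | _⟩ := d
  · exact (ref.isLink e).symm
  · exact ref.isLink e

theorem RefOrientation.exists_of_isLink {e : E(G)} {x y : V(G)}
    (h : G.IsLink (e : β) (x : α) (y : α)) :
    ∃ s : Bool, ref.src (e, s) = x ∧ ref.dst (e, s) = y := by
  rcases h.eq_and_eq_or_eq_and_eq (ref.isLink e) with ⟨h1, h2⟩ | ⟨h1, h2⟩
  · exact ⟨true, Subtype.ext h1.symm, Subtype.ext h2.symm⟩
  · exact ⟨false, Subtype.ext h1.symm, Subtype.ext h2.symm⟩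

/-- Two vertices lie in the same component of the spanning subgraph `(V(G), S)`. -/
def Joined (S : SpanningSubgraph G) (x y : V(G)) : Prop :=
  Quot.mk (fun x y : V(G) => ∃ e ∈ S, G.IsLink (e : β) (x : α) (y : α)) x =
    Quot.mk (fun x y : V(G) => ∃ e ∈ S, G.IsLink (e : β) (x : α) (y : α)) y

theorem Joined.of_mem {S : SpanningSubgraph G} {d : SignedEdge G} (h : d.1 ∈ S) :
    Joined S (ref.src d) (ref.dst d) :=
  Quot.sound ⟨d.1, h, ref.isLink_src_dst d⟩

/-- Closure of `X` in one direction suffices, because the hypothesis also applies to the reversal of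
each signed edge. -/
theorem Joined.mem_iff {S : SpanningSubgraph G} {x y : V(G)} (h : Joined S x y) {X : Set V(G)}
    (hX : ∀ d : SignedEdge G, d.1 ∈ S → ref.src d ∈ X → ref.dst d ∈ X) : x ∈ X ↔ y ∈ X := by
  have h' := congrArg (Quot.lift (fun z => z ∈ X) (by
    rintro a b ⟨e, he, hl⟩
    obtain ⟨s, rfl, rfl⟩ := ref.exists_of_isLink hl
    refine propext ⟨hX (e, s) he, fun hb => ?_⟩
    simpa using hX (SignedEdge.rev (e, s)) he (by simpa using hb))) h
  exact iff_of_eq h'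

theorem mem_edges [LinearOrder E(G)] {D : Finset (SignedEdge G)} {e : E(G)} : e ∈ edges D ↔ ∃ d ∈ D, d.1 = e := by
  simp [edges]

variable [Fintype E(G)]

open Classical in
/-- The signed edges that lead out of the vertex set `X`. -/
noncomputable def outEdges (X : Set V(G)) : Finset (SignedEdge G) :=
  Finset.univ.filter fun d => ref.src d ∈ X ∧ ref.dst d ∉ X

variable {ref}

@[simp] theorem mem_outEdges {X : Set V(G)} {d : SignedEdge G} :
    d ∈ outEdges ref X ↔ ref.src d ∈ X ∧ ref.dst d ∉ X := by
  simp [outEdges]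

variable [LinearOrder E(G)]

theorem mem_edges_outEdges {X : Set V(G)} {d : SignedEdge G} :
    d.1 ∈ edges (outEdges ref X) ↔ ¬ (ref.src d ∈ X ↔ ref.dst d ∈ X) := by
  rw [mem_edges]
  constructor
  · rintro ⟨g, hg, h⟩
    rw [mem_outEdges] at hg
    rcases SignedEdge.eq_or_eq_rev h with rfl | rfl
    · tauto
    · simp only [RefOrientation.src_rev, RefOrientation.dst_rev] at hg
      tauto
  · intro h
    by_cases hs : ref.src d ∈ X
    · exact ⟨d, by simp; tauto, rfl⟩
    · exact ⟨SignedEdge.rev d, by simp; tauto, rfl⟩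

theorem edges_outEdges_compl (X : Set V(G)) :
    edges (outEdges ref Xᶜ) = edges (outEdges ref X) := by
  ext e
  rw [show e = ((e, true) : SignedEdge G).1 from rfl, mem_edges_outEdges, mem_edges_outEdges]
  simp only [Set.mem_compl_iff]
  tauto

theorem IsDirectedCut.exists_eq {D : Finset (SignedEdge G)} (h : IsDirectedCut ref D) :
    ∃ X : Set V(G), D = outEdges ref X := by
  obtain ⟨-, X, hX⟩ := h
  exact ⟨X, Finset.ext fun d => by rw [hX, mem_outEdges]⟩

variable [Finite V(G)]

/-- The components of `Sᶜ` map onto those of `G`, so the counts differ exactly if this map is not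
injective. In that case some component of `Sᶜ` has a nonempty boundary, which lies in `S`. -/
theorem numComponents_univ_lt_iff (ref : RefOrientation G) (S : SpanningSubgraph G) :
    numComponents (Finset.univ : SpanningSubgraph G) < numComponents Sᶜ ↔
      ∃ X : Set V(G), (edges (outEdges ref X)).Nonempty ∧ edges (outEdges ref X) ⊆ S := by
  let r (S : SpanningSubgraph G) : V(G) → V(G) → Prop :=
    fun x y => ∃ e ∈ S, G.IsLink (e : β) (x : α) (y : α)
  let f : Quot (r Sᶜ) → Quot (r Finset.univ) :=
    Quot.map id fun x y ⟨e, _, hl⟩ => ⟨e, Finset.mem_univ e, hl⟩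
  have hf : Function.Surjective f := by
    rintro ⟨x⟩
    exact ⟨Quot.mk _ x, rfl⟩
  have key : numComponents (Finset.univ : SpanningSubgraph G) < numComponents Sᶜ ↔
      ¬ Function.Injective f := by
    constructor
    · intro h hinj
      exact absurd (Nat.card_le_card_of_injective f hinj) (not_le.2 h)
    · intro h
      by_contra hlt
      exact h (hf.bijective_of_nat_card_le (not_lt.1 hlt)).1
  rw [key]
  constructor
  · intro h
    simp only [Function.Injective, not_forall] at h
    obtain ⟨⟨x⟩, ⟨y⟩, hxy, hne⟩ := h
    have hj : Joined Finset.univ x y := hxy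
    by_contra! hX
    refine hne ?_
    let X : Set V(G) := {z | Joined Sᶜ x z}
    have hsub : edges (outEdges ref X) ⊆ S := by
      intro e he
      by_contra heS
      rw [show e = ((e, true) : SignedEdge G).1 from rfl, mem_edges_outEdges] at he
      have := Joined.of_mem ref (d := (e, true)) (Finset.mem_compl.2 heS)
      exact he ⟨fun h => Eq.trans h this, fun h => Eq.trans h this.symm⟩
    have hemp : edges (outEdges ref X) = ∅ := by
      by_contra hne
      exact hX X (Finset.nonempty_iff_ne_empty.2 hne) hsub
    refine (hj.mem_iff ref (X := X) fun d _ hd => ?_).1 (show Joined Sᶜ x x from rfl)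
    by_contra hd'
    exact Finset.notMem_empty d.1 (hemp ▸ mem_edges.2 ⟨d, mem_outEdges.2 ⟨hd, hd'⟩, rfl⟩)
  · rintro ⟨X, ⟨e, he⟩, hXS⟩ hinj
    rw [show e = ((e, true) : SignedEdge G).1 from rfl, mem_edges_outEdges] at he
    have hj : Joined Sᶜ (ref.src (e, true)) (ref.dst (e, true)) :=
      hinj (Joined.of_mem ref (S := Finset.univ) (d := (e, true)) (Finset.mem_univ _))
    refine he (hj.mem_iff ref fun d hd hs => ?_)
    by_contra hd'
    exact Finset.mem_compl.1 hd (hXS (mem_edges.2 ⟨d, mem_outEdges.2 ⟨hs, hd'⟩, rfl⟩))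

/-- The sets that raise the number of components are those that include a nonempty boundary, so both
families have the same minimal members. -/
theorem isCut_iff (ref : RefOrientation G) (C : SpanningSubgraph G) :
    IsCut C ↔ Minimal (fun S : SpanningSubgraph G =>
      S.Nonempty ∧ ∃ X : Set V(G), edges (outEdges ref X) = S) C := by
  have h1 : ∀ S : SpanningSubgraph G, (S.Nonempty ∧
      numComponents (Finset.univ : SpanningSubgraph G) < numComponents Sᶜ) ↔
      ∃ T ⊆ S, T.Nonempty ∧ ∃ X : Set V(G), edges (outEdges ref X) = T := by
    intro S
    rw [numComponents_univ_lt_iff ref]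
    constructor
    · rintro ⟨-, X, hX, hS⟩
      exact ⟨_, hS, hX, X, rfl⟩
    · rintro ⟨T, hTS, hT, X, rfl⟩
      exact ⟨hT.mono hTS, X, hT, hTS⟩
  unfold IsCut
  simp only [h1]
  constructor
  · rintro ⟨⟨T, hTC, hT⟩, hmin⟩
    have : T = C := hTC.antisymm (hmin ⟨T, subset_rfl, hT⟩ hTC)
    subst this
    exact ⟨hT, fun U hU hUT => hmin ⟨U, subset_rfl, hU⟩ hUT⟩
  · rintro ⟨hC, hmin⟩
    exact ⟨⟨C, subset_rfl, hC⟩, fun U ⟨T, hTU, hT⟩ hUC => (hmin hT (hTU.trans hUC)).trans hTU⟩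

theorem IsCut.exists_isDirectedCut {C : SpanningSubgraph G} (h : IsCut C) {d : SignedEdge G}
    (hd : d.1 ∈ C) : ∃ D, IsDirectedCut ref D ∧ d ∈ D ∧ edges D = C := by
  obtain ⟨X, rfl⟩ := ((isCut_iff ref C).1 h).1.2
  obtain hs | hs := (not_iff.1 (mem_edges_outEdges.1 hd)) |> fun h => em (ref.src d ∈ X)
  · exact ⟨_, ⟨h, X, fun d => mem_outEdges⟩,
      mem_outEdges.2 ⟨hs, fun h' => mem_edges_outEdges.1 hd ⟨fun _ => h', fun _ => hs⟩⟩, rfl⟩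
  · refine ⟨outEdges ref Xᶜ, ⟨?_, Xᶜ, fun d => mem_outEdges⟩, mem_outEdges.2 ⟨hs, ?_⟩,
      edges_outEdges_compl X⟩
    · rwa [edges_outEdges_compl]
    · have := mem_edges_outEdges.1 hd
      simp only [Set.mem_compl_iff, not_not]
      tauto

/-- A minimal set of out-edges through `d` is already a cut. This is proved by uncrossing it with a
smaller boundary. -/
theorem exists_isDirectedCut_subset {X : Set V(G)} {d : SignedEdge G} (hd : d ∈ outEdges ref X) :
    ∃ D, IsDirectedCut ref D ∧ d ∈ D ∧ D ⊆ outEdges ref X := by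
  obtain ⟨D, hD, hmin⟩ := exists_minimal_le_of_wellFoundedLT
    (fun D : Finset (SignedEdge G) => d ∈ D ∧ ∃ Y, D = outEdges ref Y) _ ⟨hd, X, rfl⟩
  obtain ⟨⟨hdD, Y, rfl⟩, hmin⟩ := hmin
  refine ⟨_, ⟨?_, Y, fun d => mem_outEdges⟩, hdD, hD⟩
  rw [isCut_iff ref]
  refine ⟨⟨⟨_, mem_edges.2 ⟨d, hdD, rfl⟩⟩, Y, rfl⟩, ?_⟩
  rintro _ ⟨⟨e₀, he₀⟩, Z, rfl⟩ hZY
  have hZ : ∀ g : SignedEdge G, (ref.src g ∈ Z ↔ ref.dst g ∈ Z) ∨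
      ¬ (ref.src g ∈ Y ↔ ref.dst g ∈ Y) := by
    intro g
    by_contra! h
    exact mem_edges_outEdges.1 (hZY (mem_edges_outEdges.2 (not_iff.2 (by clear * - h; tauto)))) h.2
  have hcap : ∀ W : Set V(G), (∀ g, g ∈ outEdges ref W → g ∈ outEdges ref Y) →
      d ∈ outEdges ref W → ∀ g ∈ outEdges ref Y, g ∈ outEdges ref W :=
    fun W hW hdW => hmin ⟨hdW, W, rfl⟩ hW
  -- As the boundary of `Z` lies in that of `Y`, these four sets have out-edges among those of `Y`.
  -- By minimality, any of them whose out-edges include `d` has all the out-edges of `Y`. Hence all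
  -- of these edges start on the same side of `Z`, and all end on the same side.
  have h1 := hcap (Y ∩ Z)
  have h2 := hcap (Y \ Z)
  have h3 := hcap (Y ∪ Z)
  have h4 := hcap (Y ∪ Zᶜ)
  simp only [mem_outEdges, Set.mem_inter_iff, Set.mem_sdiff, Set.mem_union, Set.mem_compl_iff]
    at h1 h2 h3 h4 hdD
  replace h1 := h1 fun g => by have := hZ g; clear * - this; tauto
  replace h2 := h2 fun g => by have := hZ g; clear * - this; tauto
  replace h3 := h3 fun g => by have := hZ g; clear * - this; tauto
  replace h4 := h4 fun g => by have := hZ g; clear * - this; tauto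
  have hsrc : ∀ g ∈ outEdges ref Y, (ref.src g ∈ Z ↔ ref.src d ∈ Z) := by
    intro g hg
    rw [mem_outEdges] at hg
    by_cases hd : ref.src d ∈ Z
    · exact iff_of_true (h1 ⟨⟨hdD.1, hd⟩, fun h => hdD.2 h.1⟩ g hg).1.2 hd
    · exact iff_of_false (h2 ⟨⟨hdD.1, hd⟩, fun h => hdD.2 h.1⟩ g hg).1.2 hd
  have hdst : ∀ g ∈ outEdges ref Y, (ref.dst g ∈ Z ↔ ref.dst d ∈ Z) := by
    intro g hg
    rw [mem_outEdges] at hg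
    by_cases hd : ref.dst d ∈ Z
    · exact iff_of_true (not_not.1 fun hn => (h4 ⟨Or.inl hdD.1, fun h => h.elim hdD.2 (· hd)⟩ g
        hg).2 (Or.inr hn)) hd
    · exact iff_of_false (fun hn => (h3 ⟨Or.inl hdD.1, fun h => h.elim hdD.2 hd⟩ g
        hg).2 (Or.inr hn)) hd
  obtain ⟨g₀, hg₀, rfl⟩ := mem_edges.1 (hZY he₀)
  have h0 := mem_edges_outEdges.1 he₀
  rw [hsrc _ hg₀, hdst _ hg₀] at h0
  intro e he
  obtain ⟨g, hg, rfl⟩ := mem_edges.1 he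
  exact mem_edges_outEdges.2 (by rwa [hsrc _ hg, hdst _ hg])

end Boundaries

/-! ### Chains on cyclic sequences -/

section CyclicSequences

variable {γ : Type*} {r : γ → γ → Prop} {c : Cycle γ}

theorem cycle_exists_cons_eq {a : γ} (ha : a ∈ c) : ∃ l : List γ, c = ((a :: l : List γ) : Cycle γ) := by
  induction c using Quotient.inductionOn with | _ l
  obtain ⟨l₁, l₂, rfl⟩ := List.append_of_mem (Cycle.mem_coe_iff.1 ha)
  refine ⟨l₂ ++ l₁, Cycle.coe_eq_coe.2 ?_⟩
  exact List.isRotated_append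

theorem cycle_chain_exists_prev (hc : c.Chain r) {a : γ} (ha : a ∈ c) : ∃ b ∈ c, r b a := by
  obtain ⟨l, rfl⟩ := cycle_exists_cons_eq ha
  rw [Cycle.chain_coe_cons] at hc
  rcases List.eq_nil_or_concat l with rfl | ⟨l, b, rfl⟩
  · exact ⟨a, ha, by simpa using hc⟩
  · refine ⟨b, by simp, ?_⟩
    rw [List.concat_eq_append, List.append_assoc, ← List.cons_append] at hc
    have := (List.isChain_append.1 hc).2.1
    simpa using this

/-- Implication `p a → p b` is transitive, and a cyclic chain of a transitive relation relates any
two members. -/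
theorem cycle_chain_forall (hc : c.Chain r) {p : γ → Prop}
    (hp : ∀ a ∈ c, ∀ b ∈ c, r a b → p a → p b) {a : γ} (ha : a ∈ c) (hpa : p a) :
    ∀ b ∈ c, p b := by
  have hchain : c.Chain fun a b => p a → p b := by
    induction c using Cycle.induction_on with
    | nil => trivial
    | cons a l =>
      rw [Cycle.chain_coe_cons] at hc ⊢
      refine hc.imp_of_mem_imp fun x y hx hy hxy => hp x ?_ y ?_ hxy
      · simp at hx ⊢; tauto
      · simp at hy ⊢; tauto
  have : IsTrans γ fun a b => p a → p b := ⟨fun _ _ _ h1 h2 h => h2 (h1 h)⟩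
  exact fun b hb => Cycle.chain_iff_pairwise.1 hchain a ha b hb hpa

theorem cycle_mem_toFinset [DecidableEq γ] {a : γ} : a ∈ c.toFinset ↔ a ∈ c := by
  induction c using Quotient.inductionOn with | _ l
  simp

end CyclicSequences

/-! ### Directed cycles, orthogonality and the painting lemma -/

section Cycles

variable {α β : Type*} {G : Graph α β} {ref : RefOrientation G}

theorem nodup_fst_rev_notMem {c : Cycle (SignedEdge G)} (h : (c.map Prod.fst).Nodup)
    {d : SignedEdge G} (hd : d ∈ c) : SignedEdge.rev d ∉ c := by
  intro hr
  obtain ⟨l, rfl⟩ := cycle_exists_cons_eq hd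
  rw [Cycle.map_coe, Cycle.nodup_coe_iff] at h
  exact SignedEdge.rev_ne d (List.inj_on_of_nodup_map h (by simpa using hr) (by simp) rfl)

variable (ref) in
/-- The signed edges in `l` lead, one after the other, from `x` to `y`. -/
def IsTrail (x : V(G)) : List (SignedEdge G) → V(G) → Prop
  | [], y => x = y
  | d :: l, y => ref.src d = x ∧ IsTrail (ref.dst d) l y

theorem IsTrail.of_append {l₁ l₂ : List (SignedEdge G)} {d : SignedEdge G} {x y : V(G)}
    (h : IsTrail ref x (l₁ ++ d :: l₂) y) : IsTrail ref (ref.src d) (d :: l₂) y := by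
  induction l₁ generalizing x with
  | nil => exact ⟨rfl, h.2⟩
  | cons a l ih => exact ih h.2

theorem IsTrail.cons_map_dst {l : List (SignedEdge G)} {x y : V(G)} (h : IsTrail ref x l y) :
    x :: l.map ref.dst = l.map ref.src ++ [y] := by
  induction l generalizing x with
  | nil => simpa [IsTrail] using h
  | cons d l ih =>
    obtain ⟨rfl, h⟩ := h
    simp [ih h]

/-- When a prepended edge starts at a vertex already visited, the closed initial piece is dropped.
-/
theorem exists_simple_trail {P : SignedEdge G → Prop} {x y : V(G)}
    (h : Relation.ReflTransGen (fun x y => ∃ d, P d ∧ ref.src d = x ∧ ref.dst d = y) x y) :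
    ∃ l : List (SignedEdge G), IsTrail ref x l y ∧ (∀ d ∈ l, P d) ∧
      (l.map ref.src ++ [y]).Nodup := by
  induction h using Relation.ReflTransGen.head_induction_on with
  | refl => exact ⟨[], rfl, by simp, by simp⟩
  | @head x z hxz _ ih =>
    obtain ⟨d, hd, rfl, rfl⟩ := hxz
    obtain ⟨l, hl, hP, hn⟩ := ih
    by_cases hx : ref.src d ∈ l.map ref.src ++ [y]
    · rw [List.mem_append, List.mem_singleton] at hx
      rcases hx with hx | hx
      · obtain ⟨g, hg, hgd⟩ := List.mem_map.1 hx
        obtain ⟨l₁, l₂, rfl⟩ := List.append_of_mem hg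
        refine ⟨g :: l₂, hgd ▸ hl.of_append, fun b hb => hP b (List.mem_append_right _ hb), ?_⟩
        rw [List.map_append, List.append_assoc] at hn
        exact (List.nodup_append.1 hn).2.1
      · exact ⟨[], hx, by simp, by simp⟩
    · exact ⟨d :: l, ⟨rfl, hl⟩, fun b hb => (List.mem_cons.1 hb).elim (· ▸ hd) (hP b),
        List.nodup_cons.2 ⟨hx, hn⟩⟩

/-- A later use of the edge `d` in either direction would start or end at `ref.src d`, so this
vertex would be visited twice. -/
theorem IsTrail.nodup_map_fst {l : List (SignedEdge G)} {x y : V(G)} (h : IsTrail ref x l y)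
    (hn : (l.map ref.src ++ [y]).Nodup) : (l.map Prod.fst).Nodup := by
  induction l generalizing x with
  | nil => simp
  | cons d l ih =>
    obtain ⟨rfl, h⟩ := h
    rw [List.map_cons, List.cons_append, List.nodup_cons] at hn
    rw [List.map_cons, List.nodup_cons]
    refine ⟨fun hd => ?_, ih h hn.2⟩
    obtain ⟨g, hg, hgd⟩ := List.mem_map.1 hd
    rcases SignedEdge.eq_or_eq_rev hgd with rfl | rfl
    · exact hn.1 (List.mem_append_left _ (List.mem_map_of_mem hg))
    · refine hn.1 (h.cons_map_dst ▸ List.mem_cons_of_mem _ ?_)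
      simpa using List.mem_map_of_mem (f := ref.dst) hg

theorem IsTrail.isChain {l : List (SignedEdge G)} {d : SignedEdge G} {y : V(G)}
    (h : IsTrail ref (ref.dst d) l y) {g : SignedEdge G} (hg : y = ref.src g) :
    List.IsChain (fun d d' => ref.dst d = ref.src d') (d :: (l ++ [g])) := by
  induction l generalizing d with
  | nil =>
    have h : ref.dst d = y := h
    simpa using h.trans hg
  | cons a l ih =>
    obtain ⟨h1, h2⟩ := h
    rw [List.cons_append, List.isChain_cons_cons]
    exact ⟨h1.symm, ih h2⟩

variable [Fintype E(G)] [LinearOrder E(G)]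

theorem IsDirectedCut.rev_notMem {D : Finset (SignedEdge G)} (h : IsDirectedCut ref D)
    {d : SignedEdge G} (hd : d ∈ D) : SignedEdge.rev d ∉ D := by
  obtain ⟨X, rfl⟩ := h.exists_eq
  rw [mem_outEdges] at hd ⊢
  simp only [RefOrientation.src_rev, RefOrientation.dst_rev]
  tauto

theorem IsDirectedCycle.rev_notMem {D : Finset (SignedEdge G)} (h : IsDirectedCycle ref D)
    {d : SignedEdge G} (hd : d ∈ D) : SignedEdge.rev d ∉ D := by
  obtain ⟨-, c, hc, rfl, -⟩ := h
  simp only [cycle_mem_toFinset] at hd ⊢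
  exact nodup_fst_rev_notMem hc hd

/-- A closed walk that leaves `X` must enter it again: otherwise it would remain outside, yet the
predecessor of `d` ends in `X`. -/
theorem exists_rev_mem_of_chain {c : Cycle (SignedEdge G)}
    (hc : c.Chain fun d d' => ref.dst d = ref.src d') {X : Set V(G)} {d : SignedEdge G}
    (hd : d ∈ c) (hX : d ∈ outEdges ref X) :
    ∃ g ∈ outEdges ref X, SignedEdge.rev g ∈ c := by
  by_contra! h
  rw [mem_outEdges] at hX
  have hall := cycle_chain_forall hc (p := fun d => ref.dst d ∉ X) (fun a _ b hb hab ha hbX => by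
    refine h (SignedEdge.rev b) ?_ (by simpa using hb)
    simp [hbX, ← hab, ha]) hd hX.2
  obtain ⟨b, hb, hbd⟩ := cycle_chain_exists_prev hc hd
  exact hall b hb (hbd ▸ hX.1)

theorem IsDirectedCut.exists_rev_mem {D D' : Finset (SignedEdge G)} (h : IsDirectedCut ref D)
    (h' : IsDirectedCycle ref D') {d : SignedEdge G} (hd : d ∈ D) (hd' : d ∈ D') :
    ∃ g ∈ D, SignedEdge.rev g ∈ D' := by
  obtain ⟨X, rfl⟩ := h.exists_eq
  obtain ⟨-, c, -, rfl, hc⟩ := h'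
  simp only [cycle_mem_toFinset] at hd' ⊢
  exact exists_rev_mem_of_chain hc hd' hd

variable [Finite V(G)]

/-- Leaving one side of the cut and returning uses two different edges, since the closed walk
repeats no edge. -/
theorem inter_edges_card_ne_one {c : Cycle (SignedEdge G)} (hn : (c.map Prod.fst).Nodup)
    (hc : c.Chain fun d d' => ref.dst d = ref.src d') {D : SpanningSubgraph G} (hD : IsCut D) :
    (D ∩ edges c.toFinset).card ≠ 1 := by
  intro h1
  obtain ⟨e, he⟩ := Finset.card_eq_one.1 h1
  have hmem : e ∈ D ∩ edges c.toFinset := he ▸ Finset.mem_singleton_self e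
  rw [Finset.mem_inter, mem_edges] at hmem
  obtain ⟨heD, d, hd, rfl⟩ := hmem
  rw [cycle_mem_toFinset] at hd
  obtain ⟨D', hD', hdD', rfl⟩ := hD.exists_isDirectedCut (ref := ref) heD
  obtain ⟨X, rfl⟩ := hD'.exists_eq
  obtain ⟨g, hg, hgc⟩ := exists_rev_mem_of_chain hc hd hdD'
  have hgm : g.1 ∈ edges (outEdges ref X) ∩ edges c.toFinset :=
    Finset.mem_inter.2 ⟨mem_edges.2 ⟨g, hg, rfl⟩,
      mem_edges.2 ⟨_, cycle_mem_toFinset.2 hgc, rfl⟩⟩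
  rw [he, Finset.mem_singleton] at hgm
  rcases SignedEdge.eq_or_eq_rev hgm with rfl | rfl
  · exact nodup_fst_rev_notMem hn hd hgc
  · exact hD'.rev_notMem hdD' hg

theorem isDirectedCycle_of_isTrail {l : List (SignedEdge G)} {f : SignedEdge G}
    (h : IsTrail ref (ref.dst f) l (ref.src f)) (hn : (l.map ref.src ++ [ref.src f]).Nodup)
    (hf : ∀ d ∈ l, d.1 ≠ f.1) :
    IsDirectedCycle ref ((f :: l : List (SignedEdge G)) : Cycle (SignedEdge G)).toFinset := by
  have hchain : ((f :: l : List (SignedEdge G)) : Cycle (SignedEdge G)).Chain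
      fun d d' => ref.dst d = ref.src d' := by
    rw [Cycle.chain_coe_cons]
    exact h.isChain rfl
  have hnodup : (((f :: l : List (SignedEdge G)) : Cycle (SignedEdge G)).map Prod.fst).Nodup := by
    rw [Cycle.map_coe, Cycle.nodup_coe_iff, List.map_cons, List.nodup_cons]
    refine ⟨fun hm => ?_, h.nodup_map_fst hn⟩
    obtain ⟨d, hd, hdf⟩ := List.mem_map.1 hm
    exact hf d hd hdf
  have hsrc : ((f :: l).map ref.src).Nodup := by
    rw [List.map_cons]
    exact (List.perm_append_singleton _ _).nodup_iff.1 hn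
  have hdst : ((f :: l).map ref.dst).Nodup := by
    rwa [List.map_cons, h.cons_map_dst]
  refine ⟨⟨⟨⟨f.1, mem_edges.2 ⟨f, by simp, rfl⟩⟩,
    fun D hD => inter_edges_card_ne_one hnodup hchain hD⟩, ?_⟩, _, hnodup, rfl, hchain⟩
  rintro T ⟨⟨t, ht⟩, hT⟩ hTS
  obtain ⟨d₀, hd₀, rfl⟩ := mem_edges.1 (hTS ht)
  -- For minimality, suppose that `T` contains an edge `d` of the cycle but not the next edge `d'`.
  -- The cycle visits their common vertex once, so a cut through `d` at that vertex meets `T` in `d`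
  -- alone.
  have hall := cycle_chain_forall hchain (p := fun d => d.1 ∈ T) (fun d hd d' hd' hdd' hdT => by
    by_contra hd'T
    have hne : ref.src d ≠ ref.src d' := fun hs =>
      hd'T (List.inj_on_of_nodup_map hsrc (by simpa using hd) (by simpa using hd') hs ▸ hdT)
    have hout : SignedEdge.rev d ∈ outEdges ref {ref.src d'} := by
      simp [hdd', hne]
    obtain ⟨D, hD, hdD, hDout⟩ := exists_isDirectedCut_subset hout
    refine hT (edges D) hD.1 (Finset.card_eq_one.2 ⟨d.1, Finset.ext fun e => ?_⟩)
    rw [Finset.mem_inter, Finset.mem_singleton]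
    constructor
    · rintro ⟨heD, heT⟩
      obtain ⟨g, hg, hge⟩ := mem_edges.1 heD
      obtain ⟨g', hg', rfl⟩ := mem_edges.1 (hTS heT)
      have hgv := mem_outEdges.1 (hDout hg)
      rcases SignedEdge.eq_or_eq_rev hge with rfl | rfl
      · exact absurd (List.inj_on_of_nodup_map hsrc (by simpa using hg') (by simpa using hd')
          hgv.1 ▸ heT) hd'T
      · have hgd : ref.dst g' = ref.dst d := by simpa [hdd'] using hgv.1
        rw [List.inj_on_of_nodup_map hdst (by simpa using hg') (by simpa using hd) hgd]
    · rintro rfl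
      exact ⟨mem_edges.2 ⟨_, hdD, rfl⟩, hdT⟩) (cycle_mem_toFinset.1 hd₀) ht
  intro e he
  obtain ⟨d, hd, rfl⟩ := mem_edges.1 he
  exact hall d (cycle_mem_toFinset.1 hd)

/-- The painting lemma: for any set `P` of admissible signed edges, the signed edge `f` lies in a
directed cycle with all other edges admissible or in a directed cut with no other edge of
admissible opposite. -/
theorem exists_isDirectedCycle_or_isDirectedCut (ref : RefOrientation G) (P : Set (SignedEdge G))
    (f : SignedEdge G) :
    (∃ D, IsDirectedCycle ref D ∧ f ∈ D ∧ ∀ g ∈ D, g.1 ≠ f.1 → g ∈ P) ∨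
      ∃ D, IsDirectedCut ref D ∧ f ∈ D ∧ ∀ g ∈ D, g.1 ≠ f.1 → SignedEdge.rev g ∉ P := by
  -- If admissible edges lead from the end of `f` back to its start, a simple such path closes up to
  -- a cycle. Otherwise the unreachable vertices have `f` among their out-edges, and no other
  -- out-edge has an admissible opposite.
  by_cases h : Relation.ReflTransGen (fun x y => ∃ d, (d ∈ P ∧ d.1 ≠ f.1) ∧
      ref.src d = x ∧ ref.dst d = y) (ref.dst f) (ref.src f)
  · obtain ⟨l, hl, hP, hn⟩ := exists_simple_trail h
    refine Or.inl ⟨_, isDirectedCycle_of_isTrail hl hn fun d hd => (hP d hd).2, by simp, ?_⟩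
    intro g hg hgf
    rw [cycle_mem_toFinset, Cycle.mem_coe_iff, List.mem_cons] at hg
    rcases hg with rfl | hg
    · exact absurd rfl hgf
    · exact (hP g hg).1
  · have hout : f ∈ outEdges ref {x | ¬ Relation.ReflTransGen (fun x y => ∃ d,
        (d ∈ P ∧ d.1 ≠ f.1) ∧ ref.src d = x ∧ ref.dst d = y) (ref.dst f) x} := by
      simp only [mem_outEdges, Set.mem_ofPred_eq, not_not]
      exact ⟨h, Relation.ReflTransGen.refl⟩
    obtain ⟨D, hD, hfD, hDout⟩ := exists_isDirectedCut_subset hout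
    refine Or.inr ⟨D, hD, hfD, fun g hg hgf hP => ?_⟩
    have := mem_outEdges.1 (hDout hg)
    simp only [Set.mem_ofPred_eq, not_not] at this
    exact this.1 (this.2.tail ⟨SignedEdge.rev g, ⟨hP, hgf⟩, by simp, by simp⟩)

/-- Painting with both directions of every edge of `C` admissible: the cut alternative would meet
`C` in a single edge. -/
theorem IsCycle.exists_isDirectedCycle {C : SpanningSubgraph G} (h : IsCycle C) {d : SignedEdge G}
    (hd : d.1 ∈ C) : ∃ D, IsDirectedCycle ref D ∧ d ∈ D ∧ edges D = C := by
  rcases exists_isDirectedCycle_or_isDirectedCut ref {g | g.1 ∈ C} d with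
    ⟨D, hD, hdD, hDC⟩ | ⟨D, hD, hdD, hDC⟩
  · refine ⟨D, hD, hdD, ?_⟩
    have hsub : edges D ⊆ C := by
      intro e he
      obtain ⟨g, hg, rfl⟩ := mem_edges.1 he
      by_cases hgd : g.1 = d.1
      · rwa [hgd]
      · exact hDC g hg hgd
    exact hsub.antisymm (h.2 hD.1.1 hsub)
  · refine absurd (Finset.card_eq_one.2 ⟨d.1, Finset.ext fun e => ?_⟩) (h.1.2 (edges D) hD.1)
    rw [Finset.mem_inter, Finset.mem_singleton]
    constructor
    · rintro ⟨he, heC⟩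
      obtain ⟨g, hg, rfl⟩ := mem_edges.1 he
      by_contra hgd
      exact hDC g hg hgd heC
    · rintro rfl
      exact ⟨mem_edges.2 ⟨d, hdD, rfl⟩, hd⟩

end Cycles

/-! ### Abstract duality of cuts and cycles, and the choice at one edge -/

section DualPairs

variable {α β : Type*} {G : Graph α β}

/-- Two families of sets of signed edges that behave like the directed cuts and the directed cycles
of a graph. -/
structure IsDualPair (𝓒 𝓛 : Finset (SignedEdge G) → Prop) : Prop where
  rev_notMem_left : ∀ {D}, 𝓒 D → ∀ {d}, d ∈ D → SignedEdge.rev d ∉ D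
  rev_notMem_right : ∀ {D}, 𝓛 D → ∀ {d}, d ∈ D → SignedEdge.rev d ∉ D
  orthogonal : ∀ {D D'}, 𝓒 D → 𝓛 D' → ∀ {d}, d ∈ D → d ∈ D' → ∃ g ∈ D, SignedEdge.rev g ∈ D'
  painting : ∀ (P : Set (SignedEdge G)) (f : SignedEdge G),
    (∃ D, 𝓛 D ∧ f ∈ D ∧ ∀ g ∈ D, g.1 ≠ f.1 → g ∈ P) ∨
      ∃ D, 𝓒 D ∧ f ∈ D ∧ ∀ g ∈ D, g.1 ≠ f.1 → SignedEdge.rev g ∉ P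

/-- The set of signed edges whose opposite is not in `O`. -/
def coSet (O : Set (SignedEdge G)) : Set (SignedEdge G) := {d | SignedEdge.rev d ∉ O}

theorem mem_coSet {O : Set (SignedEdge G)} {d : SignedEdge G} :
    d ∈ coSet O ↔ SignedEdge.rev d ∉ O := Iff.rfl

@[simp] theorem coSet_coSet (O : Set (SignedEdge G)) : coSet (coSet O) = O := by
  ext d
  simp [mem_coSet]

/-- Replace the state of the edge `e` by `p`. -/
def setState (O : Set (SignedEdge G)) (e : E(G)) (p : Bool → Prop) : Set (SignedEdge G) :=
  {d | (d.1 = e ∧ p d.2) ∨ (d.1 ≠ e ∧ d ∈ O)}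

theorem mem_setState {O : Set (SignedEdge G)} {e : E(G)} {p : Bool → Prop} {d : SignedEdge G} :
    d ∈ setState O e p ↔ (d.1 = e ∧ p d.2) ∨ (d.1 ≠ e ∧ d ∈ O) := Iff.rfl

theorem coSet_setState (O : Set (SignedEdge G)) (e : E(G)) (p : Bool → Prop) :
    coSet (setState O e p) = setState (coSet O) e fun s => ¬ p (!s) := by
  ext d
  simp only [mem_coSet, mem_setState, SignedEdge.rev_fst]
  have : (SignedEdge.rev d).2 = !d.2 := rfl
  rw [this]
  tauto

/-- The edge is present in neither direction. -/
def absent : Bool → Prop := fun _ => False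

/-- The edge is present in both directions. -/
def both : Bool → Prop := fun _ => True

/-- The edge is present in the direction `s` only. -/
def only (s : Bool) : Bool → Prop := fun t => t = s

theorem coSet_setState_only (O : Set (SignedEdge G)) (e : E(G)) (s : Bool) :
    coSet (setState O e (only s)) = setState (coSet O) e (only s) := by
  rw [coSet_setState]
  congr 1
  funext t
  cases s <;> cases t <;> simp [only]

theorem setState_mono {O : Set (SignedEdge G)} {e : E(G)} {p q : Bool → Prop}
    (h : ∀ s, p s → q s) : setState O e p ⊆ setState O e q :=
  fun _ hd => hd.imp_left (And.imp_right (h _))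

namespace IsDualPair

variable {𝓒 𝓛 : Finset (SignedEdge G) → Prop}

theorem symm (h : IsDualPair 𝓒 𝓛) : IsDualPair 𝓛 𝓒 where
  rev_notMem_left := h.rev_notMem_right
  rev_notMem_right := h.rev_notMem_left
  orthogonal := fun hD hD' d hd hd' => by
    obtain ⟨g, hg, hg'⟩ := h.orthogonal hD' hD hd' hd
    exact ⟨_, hg', by simpa using hg⟩
  painting := fun P f => by
    rcases h.painting (coSet P) f with ⟨D, h1, h2, h3⟩ | ⟨D, h1, h2, h3⟩
    · exact Or.inr ⟨D, h1, h2, h3⟩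
    · refine Or.inl ⟨D, h1, h2, fun g hg hgf => ?_⟩
      simpa [mem_coSet] using h3 g hg hgf

/-- Paint with the wanted directions admissible. If no member of `𝓒` results, there is a member of
`𝓛` through `d`; orthogonality to `D₁` forces it through `SignedEdge.rev a`, and then orthogonality
to `D₂` fails. -/
theorem elimination (h : IsDualPair 𝓒 𝓛) {D₁ D₂ : Finset (SignedEdge G)} (h₁ : 𝓒 D₁) (h₂ : 𝓒 D₂)
    {d a : SignedEdge G} (ha₁ : a ∈ D₁) (ha₂ : SignedEdge.rev a ∈ D₂) (hd₁ : d ∈ D₁)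
    (hd₂ : SignedEdge.rev d ∉ D₂) (hda : d.1 ≠ a.1) :
    ∃ D, 𝓒 D ∧ d ∈ D ∧ ∀ g ∈ D, g.1 ≠ a.1 ∧ (g ∈ D₁ ∨ g ∈ D₂) := by
  rcases h.symm.painting {g | g.1 ≠ a.1 ∧ (g ∈ D₁ ∨ g ∈ D₂)} d with
    ⟨D, hD, hdD, hDP⟩ | ⟨D, hD, hdD, hDP⟩
  · refine ⟨D, hD, hdD, fun g hg => ?_⟩
    by_cases hgd : g.1 = d.1
    · rcases SignedEdge.eq_or_eq_rev hgd with rfl | rfl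
      · exact ⟨hda, Or.inl hd₁⟩
      · exact absurd hg (h.rev_notMem_left hD hdD)
    · exact hDP g hg hgd
  · exfalso
    have haD : SignedEdge.rev a ∈ D := by
      obtain ⟨g, hg, hg'⟩ := h.symm.orthogonal hD h₁ hdD hd₁
      have hgd : g.1 ≠ d.1 := fun hgd => by
        rcases SignedEdge.eq_or_eq_rev hgd with rfl | rfl
        · exact h.rev_notMem_left h₁ hd₁ hg'
        · exact h.rev_notMem_right hD hdD hg
      have hga : g.1 = a.1 := not_not.1 fun hga => hDP g hg hgd ⟨hga, Or.inl hg'⟩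
      rcases SignedEdge.eq_or_eq_rev hga with rfl | rfl
      · exact absurd hg' (h.rev_notMem_left h₁ ha₁)
      · exact hg
    obtain ⟨g, hg, hg'⟩ := h.symm.orthogonal hD h₂ haD ha₂
    have hgd : g.1 ≠ d.1 := fun hgd => by
      rcases SignedEdge.eq_or_eq_rev hgd with rfl | rfl
      · exact hd₂ hg'
      · exact h.rev_notMem_right hD hdD hg
    have hga : g.1 = a.1 := not_not.1 fun hga => hDP g hg hgd ⟨hga, Or.inr hg'⟩
    rcases SignedEdge.eq_or_eq_rev hga with rfl | rfl
    · exact h.rev_notMem_right hD haD (by simpa using hg)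
    · exact h.rev_notMem_left h₂ ha₂ hg'

end IsDualPair

variable [LinearOrder E(G)]

/-- The signed edge `d` lies over the minimum edge of a member of `𝓓` that is included in `P`. -/
def IsMinIn (𝓓 : Finset (SignedEdge G) → Prop) (P : Set (SignedEdge G)) (d : SignedEdge G) : Prop :=
  ∃ D, 𝓓 D ∧ d ∈ D ∧ ∀ g ∈ D, d.1 ≤ g.1 ∧ g ∈ P

theorem IsMinIn.mono {𝓓 : Finset (SignedEdge G) → Prop} {P Q : Set (SignedEdge G)}
    {d : SignedEdge G} (h : IsMinIn 𝓓 P d) (hPQ : P ⊆ Q) : IsMinIn 𝓓 Q d := by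
  obtain ⟨D, hD, hd, hDP⟩ := h
  exact ⟨D, hD, hd, fun g hg => ⟨(hDP g hg).1, hPQ (hDP g hg).2⟩⟩

/-- The states `p` and `q` of the edge `e` lead to the same minimum edges below `e`, where `τ`
prescribes the directions of the minimum edges. -/
def Agree (𝓓 : Finset (SignedEdge G) → Prop) (P : Set (SignedEdge G)) (e : E(G)) (τ : E(G) → Bool)
    (p q : Bool → Prop) : Prop :=
  ∀ f < e, IsMinIn 𝓓 (setState P e p) (f, τ f) ↔ IsMinIn 𝓓 (setState P e q) (f, τ f)

namespace IsDualPair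

variable {𝓒 𝓛 : Finset (SignedEdge G) → Prop} {P : Set (SignedEdge G)} {e : E(G)}
  {τ τ' : E(G) → Bool}

theorem mem_of_not_agree {D : Finset (SignedEdge G)} {s : Bool} {d : SignedEdge G}
    (hD : 𝓒 D) (hd : d ∈ D) (hDP : ∀ g ∈ D, d.1 ≤ g.1 ∧ g ∈ setState P e (only s))
    (hn : ¬ IsMinIn 𝓒 (setState P e absent) d) : (e, s) ∈ D := by
  by_contra he
  refine hn ⟨D, hD, hd, fun g hg => ⟨(hDP g hg).1, ?_⟩⟩
  rcases (hDP g hg).2 with ⟨rfl, h2⟩ | h'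
  · exact absurd (show (g.1, s) ∈ D from h2 ▸ hg) he
  · exact Or.inr h'

theorem exists_mem_of_not_agree {s : Bool} (h : ¬ Agree 𝓒 P e τ (only s) absent) :
    ∃ f < e, ¬ IsMinIn 𝓒 (setState P e absent) (f, τ f) ∧ ∃ D, 𝓒 D ∧ (f, τ f) ∈ D ∧ (e, s) ∈ D ∧
      ∀ g ∈ D, f ≤ g.1 ∧ g ∈ setState P e (only s) := by
  simp only [Agree, not_forall] at h
  obtain ⟨f, hf, h⟩ := h
  have h2 : ¬ IsMinIn 𝓒 (setState P e absent) (f, τ f) := fun h2 =>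
    h ⟨fun _ => h2, fun h2 => h2.mono (setState_mono fun _ => False.elim)⟩
  have h1 : IsMinIn 𝓒 (setState P e (only s)) (f, τ f) := by
    by_contra h1
    exact h (iff_of_false h1 h2)
  obtain ⟨D, hD, hfD, hDP⟩ := h1
  exact ⟨f, hf, h2, D, hD, hfD, mem_of_not_agree hD hfD hDP h2, hDP⟩

theorem isMinIn_absent (h : IsDualPair 𝓒 𝓛) {D₁ D₂ : Finset (SignedEdge G)} {s : Bool}
    {d : SignedEdge G} (hde : d.1 ≠ e) (h₁ : 𝓒 D₁) (hd₁ : d ∈ D₁) (he₁ : (e, s) ∈ D₁)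
    (hD₁ : ∀ g ∈ D₁, d.1 ≤ g.1 ∧ g ∈ setState P e (only s)) (h₂ : 𝓒 D₂) (he₂ : (e, !s) ∈ D₂)
    (hd₂ : SignedEdge.rev d ∉ D₂)
    (hD₂ : ∀ g ∈ D₂, d.1 ≤ g.1 ∧ g ∈ setState P e (only !s)) :
    IsMinIn 𝓒 (setState P e absent) d := by
  obtain ⟨D, hD, hdD, hDP⟩ := h.elimination h₁ h₂ he₁ he₂ hd₁ hd₂ hde
  refine ⟨D, hD, hdD, fun g hg => ?_⟩
  obtain ⟨hge, hg | hg⟩ := hDP g hg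
  · exact ⟨(hD₁ g hg).1, Or.inr ⟨hge, ((hD₁ g hg).2.resolve_left fun h => hge h.1).2⟩⟩
  · exact ⟨(hD₂ g hg).1, Or.inr ⟨hge, ((hD₂ g hg).2.resolve_left fun h => hge h.1).2⟩⟩

/-- If both directions of `e` mattered, eliminating `e` between the two witnesses would keep the
smaller of the two minima, without using `e`. If the minima are equal they do not cancel, because
`τ` prescribes the same direction in both witnesses. -/
theorem agree_or_agree (h : IsDualPair 𝓒 𝓛) (s : Bool) :
    Agree 𝓒 P e τ (only s) absent ∨ Agree 𝓒 P e τ (only !s) absent := by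
  by_contra! hn
  obtain ⟨f₁, hf₁, hn₁, D₁, h₁, hfD₁, he₁, hD₁⟩ := exists_mem_of_not_agree hn.1
  obtain ⟨f₂, hf₂, hn₂, D₂, h₂, hfD₂, he₂, hD₂⟩ := exists_mem_of_not_agree hn.2
  rcases lt_trichotomy f₁ f₂ with hlt | rfl | hlt
  · exact hn₁ (h.isMinIn_absent hf₁.ne h₁ hfD₁ he₁ hD₁ h₂ he₂
      (fun hr => (hD₂ _ hr).1.not_gt hlt) fun g hg => ⟨hlt.le.trans (hD₂ g hg).1, (hD₂ g hg).2⟩)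
  · exact hn₁ (h.isMinIn_absent hf₁.ne h₁ hfD₁ he₁ hD₁ h₂ he₂ (h.rev_notMem_left h₂ hfD₂) hD₂)
  · exact hn₂ (h.isMinIn_absent hf₂.ne h₂ hfD₂ he₂ hD₂ h₁ (by simpa using he₁)
      (fun hr => (hD₁ _ hr).1.not_gt hlt) fun g hg =>
        ⟨hlt.le.trans (hD₁ g hg).1, by simpa using (hD₁ g hg).2⟩)

theorem isMinIn_only_or (h : IsDualPair 𝓒 𝓛) (s : Bool) {d : SignedEdge G}
    (hd : IsMinIn 𝓒 (setState P e both) d) :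
    IsMinIn 𝓒 (setState P e (only s)) d ∨ IsMinIn 𝓒 (setState P e (only !s)) d := by
  obtain ⟨D, hD, hdD, hDP⟩ := hd
  by_cases he : (e, !s) ∈ D
  · refine Or.inr ⟨D, hD, hdD, fun g hg => ⟨(hDP g hg).1, ?_⟩⟩
    rcases (hDP g hg).2 with ⟨h1, -⟩ | h1
    · rcases SignedEdge.eq_or_eq_rev (d := (e, !s)) h1 with rfl | rfl
      · exact Or.inl ⟨rfl, rfl⟩
      · exact absurd hg (h.rev_notMem_left hD he)
    · exact Or.inr h1
  · refine Or.inl ⟨D, hD, hdD, fun g hg => ⟨(hDP g hg).1, ?_⟩⟩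
    rcases (hDP g hg).2 with ⟨h1, -⟩ | h1
    · rcases SignedEdge.eq_or_eq_rev (d := (e, !s)) h1 with rfl | rfl
      · exact absurd hg he
      · exact Or.inl ⟨rfl, by simp [SignedEdge.rev, only]⟩
    · exact Or.inr h1

/-- No member uses both directions of `e`, so adding a direction that does not matter on its own has
no effect. -/
theorem agree_both (h : IsDualPair 𝓒 𝓛) {s : Bool} (hs : Agree 𝓒 P e τ (only !s) absent) :
    Agree 𝓒 P e τ (only s) both := by
  refine fun f hf => ⟨fun h' => h'.mono (setState_mono fun _ _ => trivial), fun h' => ?_⟩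
  rcases h.isMinIn_only_or s h' with h' | h'
  · exact h'
  · exact ((hs f hf).1 h').mono (setState_mono fun _ => False.elim)

/-- A direction of `e` whose presence matters for `𝓒` does not matter for `𝓛`. -/
theorem agree_of_not_agree (h : IsDualPair 𝓒 𝓛) {s : Bool}
    (hs : ¬ Agree 𝓒 P e τ (only s) absent) : Agree 𝓛 (coSet P) e τ' (only s) absent := by
  by_contra hs'
  obtain ⟨f₁, hf₁, hn₁, D₁, h₁, hfD₁, he₁, hD₁⟩ := exists_mem_of_not_agree hs
  obtain ⟨f₂, hf₂, hn₂, D₂, h₂, hfD₂, he₂, hD₂⟩ := exists_mem_of_not_agree hs'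
  obtain ⟨g, hg, hg'⟩ := h.orthogonal h₁ h₂ he₁ he₂
  have := (hD₂ _ hg').2
  rw [← coSet_setState_only, mem_coSet, SignedEdge.rev_rev] at this
  exact this (hD₁ g hg).2

/-- It is compatible with the minimum edges below `e` to make the edge `e`, if it has direction `s`,
absent for `𝓒` and present in both directions for `𝓛`, and vice versa if it has the other
direction. -/
def Good (𝓒 𝓛 : Finset (SignedEdge G) → Prop) (P : Set (SignedEdge G)) (e : E(G))
    (τ τ' : E(G) → Bool) (s : Bool) : Prop :=
  (Agree 𝓒 P e τ (only s) absent ∧ Agree 𝓛 (coSet P) e τ' (only s) both) ∧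
    Agree 𝓒 P e τ (only !s) both ∧ Agree 𝓛 (coSet P) e τ' (only !s) absent

theorem good_of_agree (h : IsDualPair 𝓒 𝓛) {s : Bool} (h1 : Agree 𝓒 P e τ (only s) absent)
    (h2 : Agree 𝓛 (coSet P) e τ' (only !s) absent) : Good 𝓒 𝓛 P e τ τ' s :=
  ⟨⟨h1, h.symm.agree_both h2⟩, h.agree_both (by simpa using h1), h2⟩

/-- Each family has at most one direction of `e` that matters, and the two families never share it.
By `good_of_agree`, a rule is good as soon as the direction made absent for each family does not
matter for it. -/
theorem good_or_good (h : IsDualPair 𝓒 𝓛) (P : Set (SignedEdge G)) (e : E(G))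
    (τ τ' : E(G) → Bool) : Good 𝓒 𝓛 P e τ τ' true ∨ Good 𝓒 𝓛 P e τ τ' false := by
  by_cases h1 : Agree 𝓒 P e τ (only true) absent
  · by_cases h2 : Agree 𝓛 (coSet P) e τ' (only false) absent
    · exact Or.inl (h.good_of_agree h1 h2)
    · refine Or.inr (h.good_of_agree ?_ ?_)
      · by_contra h3
        exact h2 (h.agree_of_not_agree h3)
      · exact (h.symm.agree_or_agree true).resolve_right h2
  · exact Or.inr (h.good_of_agree ((h.agree_or_agree true).resolve_left h1)
      (h.agree_of_not_agree h1))

/-- A member that needs `e` for a smaller minimum `f` can lose `e` by elimination against a member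
with minimum `e`, which has no edge as small as `f`. -/
theorem agree_left_of_isMinIn (h : IsDualPair 𝓒 𝓛)
    (hs : ∀ s, IsMinIn 𝓒 (setState P e (only s)) (e, s)) (s : Bool) :
    Agree 𝓒 P e τ (only s) absent := by
  by_contra hn
  obtain ⟨f, hf, hn, D, hD, hfD, heD, hDP⟩ := exists_mem_of_not_agree hn
  obtain ⟨D', hD', he, hDP'⟩ := hs !s
  exact hn (h.isMinIn_absent hf.ne hD hfD heD hDP hD' he (fun hr => (hDP' _ hr).1.not_gt hf)
    fun g hg => ⟨hf.le.trans (hDP' g hg).1, (hDP' g hg).2⟩)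

/-- A member of `𝓛` that needs `(e, s)` would share it with the given member of `𝓒`, against
orthogonality. -/
theorem agree_right_of_isMinIn (h : IsDualPair 𝓒 𝓛)
    (hs : ∀ s, IsMinIn 𝓒 (setState P e (only s)) (e, s)) (s : Bool) :
    Agree 𝓛 (coSet P) e τ' (only s) absent := by
  by_contra hn
  obtain ⟨f, hf, hn, D, hD, hfD, heD, hDP⟩ := exists_mem_of_not_agree hn
  obtain ⟨D', hD', he, hDP'⟩ := hs s
  obtain ⟨g, hg, hg'⟩ := h.orthogonal hD' hD he heD
  have := (hDP _ hg').2
  rw [← coSet_setState_only, mem_coSet, SignedEdge.rev_rev] at this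
  exact this (hDP' g hg).2

theorem good_of_isMinIn_left (h : IsDualPair 𝓒 𝓛)
    (hs : ∀ s, IsMinIn 𝓒 (setState P e (only s)) (e, s)) (s : Bool) : Good 𝓒 𝓛 P e τ τ' s :=
  h.good_of_agree (h.agree_left_of_isMinIn hs s) (h.agree_right_of_isMinIn hs !s)

theorem good_of_isMinIn_right (h : IsDualPair 𝓒 𝓛)
    (hs : ∀ s, IsMinIn 𝓛 (setState (coSet P) e (only s)) (e, s)) (s : Bool) :
    Good 𝓒 𝓛 P e τ τ' s := by
  refine h.good_of_agree ?_ (h.symm.agree_left_of_isMinIn hs !s)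
  simpa using h.symm.agree_right_of_isMinIn hs s

theorem not_isMinIn_of_isMinIn (h : IsDualPair 𝓒 𝓛) {d : SignedEdge G}
    (h1 : IsMinIn 𝓒 P d) : ¬ IsMinIn 𝓛 (coSet P) d := by
  rintro ⟨D', hD', hd', hDP'⟩
  obtain ⟨D, hD, hd, hDP⟩ := h1
  obtain ⟨g, hg, hg'⟩ := h.orthogonal hD hD' hd hd'
  have := (hDP' _ hg').2
  rw [mem_coSet, SignedEdge.rev_rev] at this
  exact this (hDP g hg).2

end IsDualPair

end DualPairs

/-! ### The recursive choice of contracted edges -/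

section Construction

variable {α β : Type*} {G : Graph α β}

open Classical in
/-- The direction of the edge `f` in `O`, where `τ` decides if `O` does not. -/
noncomputable def dirOf (τ : E(G) → Bool) (O : Set (SignedEdge G)) (f : E(G)) : Bool :=
  if (f, true) ∈ O ↔ (f, false) ∈ O then τ f else decide ((f, true) ∈ O)

theorem dirOf_congr (τ : E(G) → Bool) {O O' : Set (SignedEdge G)} {f : E(G)}
    (h : ∀ s, (f, s) ∈ O ↔ (f, s) ∈ O') : dirOf τ O f = dirOf τ O' f := by
  by_cases ht : (f, true) ∈ O <;> by_cases hf : (f, false) ∈ O <;> simp [dirOf, ← h, ht, hf]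

theorem dirOf_eq (τ : E(G) → Bool) {O : Set (SignedEdge G)} {f : E(G)} {s : Bool}
    (h : (f, s) ∈ O) (h' : (f, !s) ∉ O) : dirOf τ O f = s := by
  cases s <;> simp_all [dirOf]

theorem dirOf_eq_label (τ : E(G) → Bool) {O : Set (SignedEdge G)} {f : E(G)}
    (h : (f, true) ∈ O ↔ (f, false) ∈ O) : dirOf τ O f = τ f := by
  simp [dirOf, h]

variable [LinearOrder E(G)]

theorem IsMinIn.mem {𝓓 : Finset (SignedEdge G) → Prop} {P : Set (SignedEdge G)}
    {d : SignedEdge G} (h : IsMinIn 𝓓 P d) : d ∈ P := by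
  obtain ⟨D, -, hd, hDP⟩ := h
  exact (hDP d hd).2

/-- Among the signed edges above `d.1` and over it, only those above and `d` itself matter: a member
through `d` cannot use the opposite of `d`. -/
theorem IsMinIn.congr {𝓓 : Finset (SignedEdge G) → Prop}
    (h𝓓 : ∀ {D}, 𝓓 D → ∀ {d}, d ∈ D → SignedEdge.rev d ∉ D) {P Q : Set (SignedEdge G)}
    {d : SignedEdge G} (hd : d ∈ Q) (hPQ : ∀ g, d.1 < g.1 → g ∈ P → g ∈ Q)
    (h : IsMinIn 𝓓 P d) : IsMinIn 𝓓 Q d := by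
  obtain ⟨D, hD, hdD, hDP⟩ := h
  refine ⟨D, hD, hdD, fun g hg => ⟨(hDP g hg).1, ?_⟩⟩
  rcases (hDP g hg).1.eq_or_lt with h | h
  · rcases SignedEdge.eq_or_eq_rev h.symm with rfl | rfl
    · exact hd
    · exact absurd hg (h𝓓 hD hdD)
  · exact hPQ g h (hDP g hg).2

/-- `O` below the edge `e`, and `S` above `e`, with its edges in both directions. -/
def belowAbove (O : Set (SignedEdge G)) (S : SpanningSubgraph G) (e : E(G)) : Set (SignedEdge G) :=
  {g | (g.1 < e ∧ g ∈ O) ∨ (e < g.1 ∧ g.1 ∈ S)}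

/-- `S` on the edges in `U`, in both directions, and `O` on the other edges. -/
def splice (O : Set (SignedEdge G)) (S U : SpanningSubgraph G) : Set (SignedEdge G) :=
  {g | (g.1 ∈ U ∧ g.1 ∈ S) ∨ (g.1 ∉ U ∧ g ∈ O)}

variable (𝓒 𝓛 : Finset (SignedEdge G) → Prop) (τ τ' : E(G) → Bool)

/-- With the state `R` of the other edges, the edge `e` is the minimum of a member of `𝓓`
included in `R`, in either direction. -/
def IsMinEither (R : Set (SignedEdge G)) (e : E(G)) : Prop :=
  ∀ s, IsMinIn 𝓒 (setState R e (only s)) (e, s)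

/-- With the state `R` of the other edges, the edge `e` is contracted if it is positively oriented
and deleted if it is negatively oriented. -/
def ContractsPos (R : Set (SignedEdge G)) (e : E(G)) : Prop :=
  IsMinEither 𝓒 (coSet R) e ∨ ¬ IsMinEither 𝓛 R e ∧
    IsDualPair.Good 𝓒 𝓛 (coSet R) e (dirOf τ R) (dirOf τ' R) true

/-- The edge `e` is to be contracted, where `S` is the set of the contracted edges above `e`. -/
def Contracts (O : Set (SignedEdge G)) (S : SpanningSubgraph G) (e : E(G)) : Prop :=
  ((e, true) ∈ O ∧ (e, false) ∈ O) ∨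
    ((e, true) ∈ O ∧ (e, false) ∉ O ∧ ContractsPos 𝓒 𝓛 τ τ' (belowAbove O S e) e) ∨
    ((e, true) ∉ O ∧ (e, false) ∈ O ∧ ¬ ContractsPos 𝓒 𝓛 τ τ' (belowAbove O S e) e)

variable {𝓒 𝓛 τ τ'}

theorem IsDualPair.good_of_contractsPos (h : IsDualPair 𝓒 𝓛) {R : Set (SignedEdge G)} {e : E(G)}
    (hR : ContractsPos 𝓒 𝓛 τ τ' R e) :
    Good 𝓒 𝓛 (coSet R) e (dirOf τ R) (dirOf τ' R) true :=
  hR.elim (fun hs => h.good_of_isMinIn_left hs true) And.right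

/-- A cycle active edge admits both rules, so deleting its positive orientation is harmless; in the
remaining case the rule for `true` is not good and the other must be. -/
theorem IsDualPair.good_of_not_contractsPos (h : IsDualPair 𝓒 𝓛) {R : Set (SignedEdge G)}
    {e : E(G)} (hR : ¬ ContractsPos 𝓒 𝓛 τ τ' R e) :
    Good 𝓒 𝓛 (coSet R) e (dirOf τ R) (dirOf τ' R) false := by
  rw [ContractsPos, not_or, not_and_or, not_not] at hR
  rcases hR.2 with hs | hs
  · exact h.good_of_isMinIn_right (by rwa [coSet_coSet]) false
  · exact (h.good_or_good _ _ _ _).resolve_left hs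

theorem belowAbove_congr {O O' : Set (SignedEdge G)} {S S' : SpanningSubgraph G} {e : E(G)}
    (hO : ∀ g : SignedEdge G, g.1 < e → (g ∈ O ↔ g ∈ O')) (hS : ∀ f > e, f ∈ S ↔ f ∈ S') :
    belowAbove O S e = belowAbove O' S' e := by
  ext g
  exact or_congr (and_congr_right fun h => hO g h) (and_congr_right fun h => hS g.1 h)

theorem mem_setState_belowAbove {O : Set (SignedEdge G)} {S : SpanningSubgraph G} {e : E(G)} {p : Bool → Prop}
    {g : SignedEdge G} (hg : e < g.1) : g ∈ setState (belowAbove O S e) e p ↔ g.1 ∈ S := by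
  simp [mem_setState, belowAbove, hg, hg.ne', hg.not_gt]

theorem splice_above {O : Set (SignedEdge G)} {S U : SpanningSubgraph G} {e : E(G)}
    (hU : ∀ f, f ∈ U ↔ e < f) :
    splice O S U = setState (belowAbove O S e) e fun s => (e, s) ∈ O := by
  ext ⟨f, s⟩
  simp only [splice, belowAbove, mem_setState, hU, Set.mem_ofPred_eq]
  rcases lt_trichotomy f e with h | rfl | h
  · simp [h, h.not_gt, h.ne]
  · simp
  · simp [h, h.not_gt, h.ne']

theorem splice_insert_above {O : Set (SignedEdge G)} {S U : SpanningSubgraph G} {e : E(G)}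
    (hU : ∀ f, f ∈ U ↔ e < f) :
    splice O S (insert e U) = setState (belowAbove O S e) e fun _ => e ∈ S := by
  ext ⟨f, s⟩
  simp only [splice, belowAbove, mem_setState, Finset.mem_insert, hU, Set.mem_ofPred_eq]
  rcases lt_trichotomy f e with h | rfl | h
  · simp [h, h.not_gt, h.ne]
  · simp
  · simp [h, h.not_gt, h.ne']

namespace IsDualPair

variable {O : Set (SignedEdge G)} {S : SpanningSubgraph G}

/-- Invariance under one step of the scan. For an unoriented or bioriented edge the state does not
change at all; for an oriented one the admissibility of the chosen rule is used. -/
theorem agree_of_contracts (h : IsDualPair 𝓒 𝓛) {e : E(G)}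
    (hS : e ∈ S ↔ Contracts 𝓒 𝓛 τ τ' O S e) :
    Agree 𝓒 (coSet (belowAbove O S e)) e (dirOf τ (belowAbove O S e))
        (fun s => (e, !s) ∉ O) (fun _ => e ∉ S) ∧
      Agree 𝓛 (belowAbove O S e) e (dirOf τ' (belowAbove O S e))
        (fun s => (e, s) ∈ O) (fun _ => e ∈ S) := by
  have hst : ∀ {p q : Bool → Prop}, p true = q true → p false = q false → p = q := by
    intro p q h1 h2
    funext s
    cases s <;> assumption
  by_cases ht : (e, true) ∈ O <;> by_cases hf : (e, false) ∈ O
  · have he : e ∈ S := hS.2 (Or.inl ⟨ht, hf⟩)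
    rw [show (fun s => (e, !s) ∉ O) = fun _ => e ∉ S from hst (by simp [hf, he]) (by simp [ht, he]),
      show (fun s => (e, s) ∈ O) = fun _ => e ∈ S from hst (by simp [ht, he]) (by simp [hf, he])]
    exact ⟨fun _ _ => Iff.rfl, fun _ _ => Iff.rfl⟩
  · rw [show (fun s => (e, !s) ∉ O) = only true from hst (by simp [hf, only]) (by simp [ht, only]),
      show (fun s => (e, s) ∈ O) = only true from hst (by simp [ht, only]) (by simp [hf, only])]
    by_cases hc : ContractsPos 𝓒 𝓛 τ τ' (belowAbove O S e) e
    · have he : e ∈ S := hS.2 (Or.inr (Or.inl ⟨ht, hf, hc⟩))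
      have hg := h.good_of_contractsPos hc
      rw [Good, coSet_coSet] at hg
      simp only [he, not_true_eq_false]
      exact hg.1
    · have he : e ∉ S := fun he => by
        rcases hS.1 he with h' | h' | h' <;> tauto
      have hg := h.good_of_not_contractsPos hc
      rw [Good, coSet_coSet] at hg
      simp only [he, not_false_eq_true]
      exact hg.2
  · rw [show (fun s => (e, !s) ∉ O) = only false from hst (by simp [hf, only]) (by simp [ht, only]),
      show (fun s => (e, s) ∈ O) = only false from hst (by simp [ht, only]) (by simp [hf, only])]
    by_cases hc : ContractsPos 𝓒 𝓛 τ τ' (belowAbove O S e) e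
    · have he : e ∉ S := fun he => by
        rcases hS.1 he with h' | h' | h' <;> tauto
      have hg := h.good_of_contractsPos hc
      rw [Good, coSet_coSet] at hg
      simp only [he, not_false_eq_true]
      exact hg.2
    · have he : e ∈ S := hS.2 (Or.inr (Or.inr ⟨ht, hf, hc⟩))
      have hg := h.good_of_not_contractsPos hc
      rw [Good, coSet_coSet] at hg
      simp only [he, not_true_eq_false]
      exact hg.1
  · have he : e ∉ S := fun he => by
      rcases hS.1 he with h' | h' | h' <;> tauto
    rw [show (fun s => (e, !s) ∉ O) = fun _ => e ∉ S from hst (by simp [hf, he]) (by simp [ht, he]),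
      show (fun s => (e, s) ∈ O) = fun _ => e ∈ S from hst (by simp [ht, he]) (by simp [hf, he])]
    exact ⟨fun _ _ => Iff.rfl, fun _ _ => Iff.rfl⟩

/-- The edges of the upper set `U` are replaced one at a time from the top, each step being
invisible to smaller minima. -/
theorem isMinIn_splice_iff (h : IsDualPair 𝓒 𝓛) (hS : ∀ e, e ∈ S ↔ Contracts 𝓒 𝓛 τ τ' O S e)
    (U : SpanningSubgraph G) (hU : ∀ e ∈ U, ∀ f > e, f ∈ U) (f : E(G)) (hf : ∀ e ∈ U, f < e) :
    (IsMinIn 𝓒 (coSet (splice O S U)) (f, dirOf τ O f) ↔ IsMinIn 𝓒 (coSet O) (f, dirOf τ O f)) ∧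
      (IsMinIn 𝓛 (splice O S U) (f, dirOf τ' O f) ↔ IsMinIn 𝓛 O (f, dirOf τ' O f)) := by
  induction U using Finset.induction_on_min with
  | empty => simp [splice]
  | insert e U heU ih =>
    have hmem : ∀ f, f ∈ U ↔ e < f := fun f => ⟨heU f, fun hef =>
      (Finset.mem_insert.1 (hU e (Finset.mem_insert_self e U) f hef)).resolve_left hef.ne'⟩
    have hfe := hf e (Finset.mem_insert_self e U)
    obtain ⟨ih1, ih2⟩ := ih (fun a ha b hab => (hmem b).2 (((hmem a).1 ha).trans hab))
      fun a ha => hf a (Finset.mem_insert_of_mem ha)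
    rw [← ih1, ← ih2, splice_insert_above hmem, splice_above hmem, coSet_setState,
      coSet_setState]
    obtain ⟨h1, h2⟩ := h.agree_of_contracts (hS e)
    -- The rule at `e` uses directions read off from the current state, which still agrees with `O`
    -- at `f`.
    have hdir : ∀ τ : E(G) → Bool, dirOf τ (belowAbove O S e) f = dirOf τ O f := fun τ =>
      dirOf_congr τ fun s => by simp [belowAbove, hfe, hfe.not_gt]
    have h1 := h1 f hfe
    have h2 := h2 f hfe
    rw [hdir] at h1 h2
    exact ⟨h1.symm, h2.symm⟩

end IsDualPair

variable [Fintype E(G)]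

variable (𝓒 𝓛 τ τ') in
theorem exists_forall_mem_iff_contracts (O : Set (SignedEdge G)) :
    ∃ S : SpanningSubgraph G, ∀ e, e ∈ S ↔ Contracts 𝓒 𝓛 τ τ' O S e := by
  classical
  -- Recursion from the greatest edge downwards: the decision at `e` refers only to decisions above
  -- `e`.
  let F : ∀ e : E(G), (∀ f, f > e → Prop) → Prop := fun e ih =>
    Contracts 𝓒 𝓛 τ τ' O (Finset.univ.filter fun f => ∃ h : f > e, ih f h) e
  let p : E(G) → Prop := (wellFounded_gt (α := E(G))).fix F
  refine ⟨Finset.univ.filter p, fun e => ?_⟩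
  rw [Finset.mem_filter_univ]
  refine Iff.trans (iff_of_eq (WellFounded.fix_eq _ F e)) ?_
  simp only [F, Contracts]
  rw [belowAbove_congr (S' := Finset.univ.filter p) (fun _ _ => Iff.rfl)]
  intro f hf
  simp only [Finset.mem_filter_univ, exists_prop]
  exact and_iff_right hf

namespace IsDualPair

variable {O : Set (SignedEdge G)} {S : SpanningSubgraph G}

theorem isMinIn_above_iff (h : IsDualPair 𝓒 𝓛) (hS : ∀ e, e ∈ S ↔ Contracts 𝓒 𝓛 τ τ' O S e)
    (e : E(G)) :
    (IsMinIn 𝓒 (coSet (setState (belowAbove O S e) e fun s => (e, s) ∈ O)) (e, dirOf τ O e) ↔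
        IsMinIn 𝓒 (coSet O) (e, dirOf τ O e)) ∧
      (IsMinIn 𝓛 (setState (belowAbove O S e) e fun s => (e, s) ∈ O) (e, dirOf τ' O e) ↔
        IsMinIn 𝓛 O (e, dirOf τ' O e)) := by
  classical
  have hU : ∀ f, f ∈ (Finset.univ.filter fun f => e < f) ↔ e < f := fun f => by simp
  rw [← splice_above hU]
  exact h.isMinIn_splice_iff hS _ (fun a ha b hab => (hU b).2 (((hU a).1 ha).trans hab)) e
    fun a ha => (hU a).1 ha

/-- Upward induction: with `O` known below `e`, the rule at `e` is known, and it contracts exactly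
one orientation. Whether `e` is contracted and whether it is oriented then determine its state. -/
theorem eq_of_contracts {O' : Set (SignedEdge G)}
    (hS : ∀ e, e ∈ S ↔ Contracts 𝓒 𝓛 τ τ' O S e) (hS' : ∀ e, e ∈ S ↔ Contracts 𝓒 𝓛 τ τ' O' S e)
    (hO : ∀ e, ((e, true) ∈ O ↔ (e, false) ∈ O) ↔ ((e, true) ∈ O' ↔ (e, false) ∈ O')) :
    O = O' := by
  have key : ∀ e : E(G), ∀ s, (e, s) ∈ O ↔ (e, s) ∈ O' := by
    intro e
    induction e using WellFoundedLT.induction with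
    | ind e ih =>
    have h1 := (hS e).symm.trans (hS' e)
    rw [Contracts, Contracts,
      belowAbove_congr (O := O) (O' := O') (S' := S) (fun g hg => ih g.1 hg g.2)
        (fun _ _ => Iff.rfl)] at h1
    have h2 := hO e
    rw [Bool.forall_bool]
    tauto
  ext ⟨e, s⟩
  exact key e s

end IsDualPair

end Construction

/-! ### Existence of an activity map -/

section ActivityMaps

variable {α β : Type*} {G : Graph α β} [Fintype E(G)] [LinearOrder E(G)]
  {ref : RefOrientation G}

theorem mem_cutActive {S : SpanningSubgraph G} {e : E(G)} : e ∈ cutActive S ↔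
    ∃ C : SpanningSubgraph G, IsCut C ∧ Disjoint C (S.erase e) ∧ IsLeast (C : Set E(G)) e := by
  simp only [cutActive, Finset.mem_filter, Finset.mem_univ, true_and]
  congr!

theorem mem_cycleActive {S : SpanningSubgraph G} {e : E(G)} : e ∈ cycleActive S ↔
    ∃ C : SpanningSubgraph G, IsCycle C ∧ C ⊆ insert e S ∧ IsLeast (C : Set E(G)) e := by
  simp only [cycleActive, Finset.mem_filter, Finset.mem_univ, true_and]
  congr!

theorem isMinOfPotentialCut_iff {O : Four G} {e : E(G)} : IsMinOfPotentialCut ref O e ↔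
    ∃ s, IsMinIn (IsDirectedCut ref) (coSet (O : Set (SignedEdge G))) (e, s) := by
  constructor
  · rintro ⟨D, ⟨hD, hDO⟩, he, hmin⟩
    obtain ⟨d, hd, rfl⟩ := mem_edges.1 he
    exact ⟨d.2, D, hD, hd, fun g hg => ⟨hmin (mem_edges.2 ⟨g, hg, rfl⟩), hDO g hg⟩⟩
  · rintro ⟨s, D, hD, hd, hDO⟩
    refine ⟨D, ⟨hD, fun g hg => (hDO g hg).2⟩, mem_edges.2 ⟨_, hd, rfl⟩, fun f hf => ?_⟩
    obtain ⟨g, hg, rfl⟩ := mem_edges.1 hf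
    exact (hDO g hg).1

theorem isMinOfPotentialCycle_iff {O : Four G} {e : E(G)} : IsMinOfPotentialCycle ref O e ↔
    ∃ s, IsMinIn (IsDirectedCycle ref) (O : Set (SignedEdge G)) (e, s) := by
  constructor
  · rintro ⟨D, ⟨hD, hDO⟩, he, hmin⟩
    obtain ⟨d, hd, rfl⟩ := mem_edges.1 he
    exact ⟨d.2, D, hD, hd, fun g hg => ⟨hmin (mem_edges.2 ⟨g, hg, rfl⟩), hDO hg⟩⟩
  · rintro ⟨s, D, hD, hd, hDO⟩
    refine ⟨D, ⟨hD, fun g hg => (hDO g hg).2⟩, mem_edges.2 ⟨_, hd, rfl⟩, fun f hf => ?_⟩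
    obtain ⟨g, hg, rfl⟩ := mem_edges.1 hf
    exact (hDO g hg).1

theorem isMinOfPotentialCut_iff_of_mem {O : Four G} {d : SignedEdge G} (hd : d ∈ O) : IsMinOfPotentialCut ref O d.1 ↔
      IsMinIn (IsDirectedCut ref) (coSet (O : Set (SignedEdge G))) d := by
  rw [isMinOfPotentialCut_iff]
  refine ⟨fun ⟨s, hs⟩ => ?_, fun h => ⟨d.2, h⟩⟩
  rcases SignedEdge.eq_or_eq_rev (d := d) (g := (d.1, s)) rfl with h | h
  · rwa [h] at hs
  · have := hs.mem
    rw [h, mem_coSet, SignedEdge.rev_rev] at this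
    exact absurd hd this

theorem isMinOfPotentialCycle_iff_of_mem {O : Four G} {d : SignedEdge G}
    (hr : SignedEdge.rev d ∉ O) : IsMinOfPotentialCycle ref O d.1 ↔
      IsMinIn (IsDirectedCycle ref) (O : Set (SignedEdge G)) d := by
  rw [isMinOfPotentialCycle_iff]
  refine ⟨fun ⟨s, hs⟩ => ?_, fun h => ⟨d.2, h⟩⟩
  rcases SignedEdge.eq_or_eq_rev (d := d) (g := (d.1, s)) rfl with h | h
  · rwa [h] at hs
  · exact absurd (h ▸ hs.mem) hr

/-- Inserting `d` only excludes potential cuts through the opposite of `d`; this is how a label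
selects the direction in which an unoriented edge is tested. -/
theorem isMinOfPotentialCut_insert_iff {O : Four G} {d : SignedEdge G} (hd : d ∉ O)
    (hr : SignedEdge.rev d ∉ O) : IsMinOfPotentialCut ref (insert d O) d.1 ↔
      IsMinIn (IsDirectedCut ref) (coSet (O : Set (SignedEdge G))) d := by
  have hr' : SignedEdge.rev d ∉ insert d O := by
    simp [hr, SignedEdge.rev_ne]
  rw [isMinOfPotentialCut_iff_of_mem (Finset.mem_insert_self d O)]
  have hgd : ∀ g : SignedEdge G, d.1 < g.1 → SignedEdge.rev g ≠ d := by
    rintro g hg rfl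
    exact hg.ne rfl
  constructor
  · refine IsMinIn.congr (fun h _ => h.rev_notMem) hr fun g hg h => ?_
    simp only [mem_coSet, Finset.coe_insert, Set.mem_insert_iff, not_or] at h
    exact h.2
  · refine IsMinIn.congr (fun h _ => h.rev_notMem) hr' fun g hg h => ?_
    simp only [mem_coSet, Finset.coe_insert, Set.mem_insert_iff, not_or]
    exact ⟨hgd g hg, h⟩

theorem isMinOfPotentialCycle_erase_iff {O : Four G} {d : SignedEdge G} (hd : d ∈ O) :
    IsMinOfPotentialCycle ref (O.erase (SignedEdge.rev d)) d.1 ↔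
      IsMinIn (IsDirectedCycle ref) (O : Set (SignedEdge G)) d := by
  rw [isMinOfPotentialCycle_iff_of_mem (Finset.notMem_erase _ _)]
  constructor
  · exact fun h => h.mono (by simp)
  · refine IsMinIn.congr (fun h _ => h.rev_notMem) (by simp [hd, (SignedEdge.rev_ne d).symm])
      fun g hg h => ?_
    simp only [Finset.coe_erase, Set.mem_sdiff, Set.mem_singleton_iff]
    refine ⟨h, ?_⟩
    rintro rfl
    exact hg.ne rfl

section EdgeStates

variable {O : Four G} {e : E(G)}

theorem mem_posEdges : e ∈ posEdges O ↔ (e, true) ∈ O ∧ (e, false) ∉ O := by simp [posEdges]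

theorem mem_negEdges : e ∈ negEdges O ↔ (e, false) ∈ O ∧ (e, true) ∉ O := by simp [negEdges]

theorem mem_orientedEdges : e ∈ orientedEdges O ↔ ¬ ((e, true) ∈ O ↔ (e, false) ∈ O) := by
  simp only [orientedEdges, Finset.mem_union, mem_posEdges, mem_negEdges]
  tauto

theorem mem_unorientedEdges : e ∈ unorientedEdges O ↔ (e, true) ∉ O ∧ (e, false) ∉ O := by
  simp [unorientedEdges]

theorem mem_biorientedEdges : e ∈ biorientedEdges O ↔ (e, true) ∈ O ∧ (e, false) ∈ O := by
  simp [biorientedEdges]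

theorem exists_mem_of_mem_orientedEdges (h : e ∈ orientedEdges O) :
    ∃ s, (e, s) ∈ O ∧ (e, !s) ∉ O := by
  rw [mem_orientedEdges] at h
  rw [Bool.exists_bool]
  simp only [Bool.not_true, Bool.not_false]
  tauto

theorem mem_orientedCutActive : e ∈ orientedCutActive ref O ↔
    e ∈ orientedEdges O ∧ IsMinOfPotentialCut ref O e := by
  simp only [orientedCutActive, Finset.mem_filter]

theorem mem_orientedCycleActive : e ∈ orientedCycleActive ref O ↔
    e ∈ orientedEdges O ∧ IsMinOfPotentialCycle ref O e := by
  simp only [orientedCycleActive, Finset.mem_filter]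

theorem mem_unorientedCutActive {σ : E(G) → Bool} : e ∈ unorientedCutActive ref σ O ↔
    e ∈ unorientedEdges O ∧ IsMinOfPotentialCut ref (insert (e, σ e) O) e := by
  simp only [unorientedCutActive, Finset.mem_filter]
  congr!

theorem mem_biorientedCycleActive {σ : E(G) → Bool} : e ∈ biorientedCycleActive ref σ O ↔
    e ∈ biorientedEdges O ∧ IsMinOfPotentialCycle ref (O.erase (e, σ e)) e := by
  simp only [biorientedCycleActive, Finset.mem_filter]
  congr!

theorem eq_biorientedEdges {S : SpanningSubgraph G} (h : Disjoint (unorientedEdges O) S)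
    (h' : biorientedEdges O ⊆ S) (hO : orientedEdges O = ∅) : S = biorientedEdges O := by
  refine Finset.Subset.antisymm (fun e he => ?_) h'
  have h1 := Finset.disjoint_right.1 h he
  have h2 : e ∉ orientedEdges O := hO ▸ Finset.notMem_empty e
  rw [mem_unorientedEdges] at h1
  rw [mem_orientedEdges] at h2
  rw [mem_biorientedEdges]
  clear * - h1 h2
  tauto

end EdgeStates

theorem card_filter_eq_of_bijective {φ : Four G → SpanningSubgraph G}
    (h : Function.Bijective fun O : Four G => (φ O, orientedEdges O)) (S : SpanningSubgraph G) :
    (Finset.univ.filter fun O => φ O = S).card = 2 ^ Fintype.card E(G) := by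
  have : (Finset.univ.filter fun O => φ O = S).card =
      (Finset.univ : Finset (SpanningSubgraph G)).card := by
    refine Finset.card_bij (fun O _ => orientedEdges O) (fun _ _ => Finset.mem_univ _) ?_ ?_
    · intro O hO O' hO' hOO'
      rw [Finset.mem_filter_univ] at hO hO'
      exact h.1 (Prod.ext (hO.trans hO'.symm) hOO')
    · intro T _
      obtain ⟨O, hO⟩ := h.2 (S, T)
      rw [Prod.ext_iff] at hO
      exact ⟨O, (Finset.mem_filter_univ _).2 hO.1, hO.2⟩
  rw [this, Finset.card_univ, Fintype.card_finset]

variable [Finite V(G)]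

variable (ref) in
theorem isDualPair : IsDualPair (IsDirectedCut ref) (IsDirectedCycle ref) where
  rev_notMem_left h _ hd := h.rev_notMem hd
  rev_notMem_right h _ hd := h.rev_notMem hd
  orthogonal h h' _ hd hd' := h.exists_rev_mem h' hd hd'
  painting := exists_isDirectedCycle_or_isDirectedCut ref

/-- When all edges above `d.1` are contracted or deleted, directions impose no restriction there,
and any cut can be oriented so that it contains `d`. -/
theorem isMinIn_cut_iff {Q : Set (SignedEdge G)} {S : SpanningSubgraph G} {d : SignedEdge G}
    (hQ : ∀ g : SignedEdge G, d.1 < g.1 → (g ∈ Q ↔ g.1 ∈ S)) (hd : SignedEdge.rev d ∉ Q) :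
    IsMinIn (IsDirectedCut ref) (coSet Q) d ↔ d.1 ∈ cutActive S := by
  rw [mem_cutActive]
  constructor
  · rintro ⟨D, hD, hdD, hDQ⟩
    refine ⟨edges D, hD.1, Finset.disjoint_left.2 fun e he heS => ?_, ?_, ?_⟩
    · obtain ⟨g, hg, rfl⟩ := mem_edges.1 he
      rw [Finset.mem_erase] at heS
      exact (hDQ g hg).2 ((hQ (SignedEdge.rev g)
        ((hDQ g hg).1.lt_of_ne heS.1.symm)).2 heS.2)
    · exact mem_edges.2 ⟨d, hdD, rfl⟩
    · intro e he
      obtain ⟨g, hg, rfl⟩ := mem_edges.1 he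
      exact (hDQ g hg).1
  · rintro ⟨C, hC, hCS, hdC, hmin⟩
    obtain ⟨D, hD, hdD, rfl⟩ := hC.exists_isDirectedCut (ref := ref) hdC
    refine ⟨D, hD, hdD, fun g hg => ?_⟩
    have hgC : g.1 ∈ edges D := mem_edges.2 ⟨g, hg, rfl⟩
    refine ⟨hmin hgC, ?_⟩
    by_cases hgd : g.1 = d.1
    · rcases SignedEdge.eq_or_eq_rev hgd with rfl | rfl
      · exact hd
      · exact absurd hg (hD.rev_notMem hdD)
    · rw [mem_coSet, hQ (SignedEdge.rev g) ((hmin hgC).lt_of_ne (Ne.symm hgd))]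
      exact fun hgS => Finset.disjoint_left.1 hCS hgC (Finset.mem_erase.2 ⟨hgd, hgS⟩)

theorem isMinIn_cycle_iff {Q : Set (SignedEdge G)} {S : SpanningSubgraph G} {d : SignedEdge G}
    (hQ : ∀ g : SignedEdge G, d.1 < g.1 → (g ∈ Q ↔ g.1 ∈ S)) (hd : d ∈ Q) :
    IsMinIn (IsDirectedCycle ref) Q d ↔ d.1 ∈ cycleActive S := by
  rw [mem_cycleActive]
  constructor
  · rintro ⟨D, hD, hdD, hDQ⟩
    refine ⟨edges D, hD.1, fun e he => ?_, ?_, ?_⟩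
    · obtain ⟨g, hg, rfl⟩ := mem_edges.1 he
      rw [Finset.mem_insert]
      by_cases hgd : g.1 = d.1
      · exact Or.inl hgd
      · exact Or.inr ((hQ g ((hDQ g hg).1.lt_of_ne (Ne.symm hgd))).1 (hDQ g hg).2)
    · exact mem_edges.2 ⟨d, hdD, rfl⟩
    · intro e he
      obtain ⟨g, hg, rfl⟩ := mem_edges.1 he
      exact (hDQ g hg).1
  · rintro ⟨C, hC, hCS, hdC, hmin⟩
    obtain ⟨D, hD, hdD, rfl⟩ := hC.exists_isDirectedCycle (ref := ref) hdC
    refine ⟨D, hD, hdD, fun g hg => ?_⟩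
    have hgC : g.1 ∈ edges D := mem_edges.2 ⟨g, hg, rfl⟩
    refine ⟨hmin hgC, ?_⟩
    by_cases hgd : g.1 = d.1
    · rcases SignedEdge.eq_or_eq_rev hgd with rfl | rfl
      · exact hd
      · exact absurd hg (hD.rev_notMem hdD)
    · exact (hQ g ((hmin hgC).lt_of_ne (Ne.symm hgd))).2
        ((Finset.mem_insert.1 (hCS hgC)).resolve_left hgd)

section Map

variable {σu σb : E(G) → Bool} {O : Four G} {S : SpanningSubgraph G}
  (hS : ∀ e, e ∈ S ↔ Contracts (IsDirectedCut ref) (IsDirectedCycle ref) σu (fun e => !σb e)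
    (O : Set (SignedEdge G)) S e)

include hS in
theorem mem_cutActive_iff_of_contracts {e : E(G)} {s : Bool} (he : (e, !s) ∉ O)
    (hs : dirOf σu (O : Set (SignedEdge G)) e = s) :
    e ∈ cutActive S ↔ IsMinIn (IsDirectedCut ref) (coSet (O : Set (SignedEdge G))) (e, s) := by
  have h := ((isDualPair ref).isMinIn_above_iff hS e).1
  rw [hs] at h
  rw [← h, isMinIn_cut_iff (S := S) (d := (e, s)) (fun g hg => mem_setState_belowAbove hg)]
  exact fun hr => hr.elim (fun h => he h.2) fun h => h.1 rfl

include hS in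
theorem mem_cycleActive_iff_of_contracts {e : E(G)} {s : Bool} (he : (e, s) ∈ O)
    (hs : dirOf (fun e => !σb e) (O : Set (SignedEdge G)) e = s) :
    e ∈ cycleActive S ↔ IsMinIn (IsDirectedCycle ref) (O : Set (SignedEdge G)) (e, s) := by
  have h := ((isDualPair ref).isMinIn_above_iff hS e).2
  rw [hs] at h
  rw [← h, isMinIn_cycle_iff (S := S) (d := (e, s)) (fun g hg => mem_setState_belowAbove hg)]
  exact Or.inl ⟨rfl, he⟩

theorem isMinEither_cut_iff {O : Set (SignedEdge G)} {e : E(G)} :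
    IsMinEither (IsDirectedCut ref) (coSet (belowAbove O S e)) e ↔ e ∈ cutActive S := by
  refine Iff.trans (forall_congr' fun s => ?_) (forall_const Bool)
  rw [← coSet_setState_only, isMinIn_cut_iff (S := S) (d := (e, s)) (fun g hg => mem_setState_belowAbove hg)]
  simp [mem_setState, only, SignedEdge.rev]

theorem isMinEither_cycle_iff {O : Set (SignedEdge G)} {e : E(G)} :
    IsMinEither (IsDirectedCycle ref) (belowAbove O S e) e ↔ e ∈ cycleActive S := by
  refine Iff.trans (forall_congr' fun s => ?_) (forall_const Bool)
  rw [isMinIn_cycle_iff (S := S) (d := (e, s)) (fun g hg => mem_setState_belowAbove hg)]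
  exact Or.inl ⟨rfl, rfl⟩

theorem notMem_cutActive_of_mem_cycleActive (ref : RefOrientation G) {e : E(G)} (h : e ∈ cycleActive S) :
    e ∉ cutActive S := by
  intro h'
  rw [← isMinEither_cycle_iff (O := ∅) (ref := ref)] at h
  rw [← isMinEither_cut_iff (O := ∅) (ref := ref)] at h'
  refine (isDualPair ref).not_isMinIn_of_isMinIn (h' true) ?_
  rw [coSet_setState_only, coSet_coSet]
  exact h true

end Map

variable (ref) in
theorem exists_isActivityMap (σu σb : E(G) → Bool) : ∃ φ, IsActivityMap ref σu σb φ := by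
  -- The cycle label is negated because removing the direction `σb e` from a bioriented edge leaves
  -- the opposite one.
  choose φ hφ using fun O : Four G => exists_forall_mem_iff_contracts (IsDirectedCut ref)
    (IsDirectedCycle ref) σu (fun e => !σb e) (O : Set (SignedEdge G))
  have hbij : Function.Bijective fun O : Four G => (φ O, orientedEdges O) := by
    rw [Fintype.bijective_iff_injective_and_card]
    constructor
    · intro O O' h
      rw [Prod.ext_iff] at h
      refine Finset.coe_injective (IsDualPair.eq_of_contracts (hφ O) (S := φ O) ?_ fun e => ?_)
      · rw [show φ O = φ O' from h.1]
        exact hφ O'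
      · have := Finset.ext_iff.1 h.2 e
        simp only [mem_orientedEdges] at this
        exact not_iff_not.1 this
    -- There are 2^(2|E|) fourientations and equally many pairs of edge sets.
    · simp only [Fintype.card_finset, Fintype.card_prod, Fintype.card_bool, pow_mul,
        Nat.mul_comm (Fintype.card E(G)) 2, ← mul_pow]
      norm_num
  have hdisj : ∀ O, Disjoint (unorientedEdges O) (φ O) := fun O =>
    Finset.disjoint_left.2 fun e he heS => by
      rw [mem_unorientedEdges] at he
      rcases (hφ O e).1 heS with h | h | h <;> simp only [Finset.mem_coe] at h <;> tauto
  have hsub : ∀ O, biorientedEdges O ⊆ φ O := fun O e he =>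
    (hφ O e).2 (Or.inl (mem_biorientedEdges.1 he))
  have hpos : ∀ {O e}, e ∈ posEdges O → (e ∈ φ O ↔ ContractsPos (IsDirectedCut ref)
      (IsDirectedCycle ref) σu (fun e => !σb e) (belowAbove (O : Set (SignedEdge G)) (φ O) e) e) := by
    intro O e he
    rw [mem_posEdges] at he
    simp [hφ O e, Contracts, he.1, he.2]
  have hneg : ∀ {O e}, e ∈ negEdges O → (e ∈ φ O ↔ ¬ ContractsPos (IsDirectedCut ref)
      (IsDirectedCycle ref) σu (fun e => !σb e) (belowAbove (O : Set (SignedEdge G)) (φ O) e) e) := by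
    intro O e he
    rw [mem_negEdges] at he
    simp [hφ O e, Contracts, he.1, he.2]
  -- The tests in `ContractsPos` yield the sign conditions: a cut active edge passes the first, and
  -- a cycle active edge, not being cut active, fails both.
  have hcut : ∀ {O e}, e ∈ cutActive (φ O) → ContractsPos (IsDirectedCut ref)
      (IsDirectedCycle ref) σu (fun e => !σb e) (belowAbove (O : Set (SignedEdge G)) (φ O) e) e :=
    fun he => Or.inl (isMinEither_cut_iff.2 he)
  have hcyc : ∀ {O e}, e ∈ cycleActive (φ O) → ¬ ContractsPos (IsDirectedCut ref)
      (IsDirectedCycle ref) σu (fun e => !σb e) (belowAbove (O : Set (SignedEdge G)) (φ O) e) e := by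
    rintro O e he (h | h)
    · exact notMem_cutActive_of_mem_cycleActive ref he (isMinEither_cut_iff.1 h)
    · exact h.1 (isMinEither_cycle_iff.2 he)
  have hφ_eq : ∀ O, orientedEdges O = ∅ → φ O = biorientedEdges O := fun O =>
    eq_biorientedEdges (hdisj O) (hsub O)
  refine ⟨φ, ⟨card_filter_eq_of_bijective hbij, hbij, hdisj, hsub, fun O => ?_, fun O => ?_,
    fun O => ?_, fun O => ?_, fun O e he => ?_, fun O => Finset.disjoint_left.2 fun e he heS => ?_,
    fun O e he => ?_, fun O => Finset.disjoint_left.2 fun e he heS => ?_,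
    fun O hO => congrArg cutActive (hφ_eq O hO), fun O hO => congrArg cycleActive (hφ_eq O hO)⟩⟩
  · ext e
    rw [Finset.mem_inter, mem_orientedCutActive, and_comm]
    refine and_congr_right fun he => ?_
    obtain ⟨s, hs, hs'⟩ := exists_mem_of_mem_orientedEdges he
    exact (mem_cutActive_iff_of_contracts (hφ O) hs' (dirOf_eq _ hs hs')).trans
      (isMinOfPotentialCut_iff_of_mem (d := (e, s)) hs).symm
  · ext e
    rw [Finset.mem_inter, mem_unorientedCutActive, and_comm]
    refine and_congr_right fun he => ?_
    rw [mem_unorientedEdges] at he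
    have h : ∀ s, (e, s) ∉ O := Bool.forall_bool.2 ⟨he.2, he.1⟩
    exact (mem_cutActive_iff_of_contracts (hφ O) (h _)
      (dirOf_eq_label _ (iff_of_false he.1 he.2))).trans
      (isMinOfPotentialCut_insert_iff (d := (e, σu e)) (h _) (h _)).symm
  · ext e
    rw [Finset.mem_inter, mem_orientedCycleActive, and_comm]
    refine and_congr_right fun he => ?_
    obtain ⟨s, hs, hs'⟩ := exists_mem_of_mem_orientedEdges he
    exact (mem_cycleActive_iff_of_contracts (hφ O) hs (dirOf_eq _ hs hs')).trans
      (isMinOfPotentialCycle_iff_of_mem (d := (e, s)) hs').symm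
  · ext e
    rw [Finset.mem_inter, mem_biorientedCycleActive, and_comm]
    refine and_congr_right fun he => ?_
    rw [mem_biorientedEdges] at he
    have h : ∀ s, (e, s) ∈ O := Bool.forall_bool.2 ⟨he.2, he.1⟩
    refine (mem_cycleActive_iff_of_contracts (hφ O) (h _)
      (dirOf_eq_label _ (iff_of_true he.1 he.2))).trans ?_
    rw [← isMinOfPotentialCycle_erase_iff (h _)]
    simp [SignedEdge.rev]
  · rw [Finset.mem_inter] at he
    exact (hpos he.2).2 (hcut he.1)
  · rw [Finset.mem_inter] at he
    exact (hneg he.2).1 heS (hcut he.1)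
  · rw [Finset.mem_inter] at he
    exact (hneg he.2).2 (hcyc he.1)
  · rw [Finset.mem_inter] at he
    exact hcyc he.1 ((hpos he.2).1 heS)

end ActivityMaps

/-! ### Activities count components and independent cycles -/

section Counting

variable {α β : Type*} {G : Graph α β}

theorem numComponents_empty : numComponents (∅ : SpanningSubgraph G) = Nat.card V(G) := by
  refine (Nat.card_eq_of_bijective (Quot.mk _) ⟨fun x y h => ?_, Quot.mk_surjective⟩).symm
  exact congrArg (Quot.lift id fun _ _ ⟨e, he, _⟩ => absurd he (Finset.notMem_empty e)) h

variable [LinearOrder E(G)]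

theorem numComponents_insert_of_joined (ref : RefOrientation G) {A : SpanningSubgraph G}
    {d : SignedEdge G} (h : Joined A (ref.src d) (ref.dst d)) :
    numComponents (insert d.1 A) = numComponents A := by
  refine (Nat.card_eq_of_bijective (Quot.map id fun x y ⟨e, he, hl⟩ =>
    ⟨e, Finset.mem_insert_of_mem he, hl⟩) ⟨?_, ?_⟩).symm
  · refine Function.LeftInverse.injective (g := Quot.lift (Quot.mk _) ?_) ?_
    · rintro x y ⟨e, he, hl⟩
      obtain ⟨s, rfl, rfl⟩ := ref.exists_of_isLink hl
      rcases Finset.mem_insert.1 he with rfl | he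
      · rcases SignedEdge.eq_or_eq_rev (d := d) (g := (d.1, s)) rfl with h' | h'
        · rw [h']
          exact h
        · rw [h', RefOrientation.src_rev, RefOrientation.dst_rev]
          exact h.symm
      · exact Joined.of_mem ref (d := (e, s)) he
    · rintro ⟨x⟩
      rfl
  · rintro ⟨x⟩
    exact ⟨Quot.mk _ x, rfl⟩

/-- The components of `A` other than that of `ref.src d` correspond to the components after
inserting the edge. -/
theorem numComponents_insert_of_not_joined [Finite V(G)] (ref : RefOrientation G)
    {A : SpanningSubgraph G} {d : SignedEdge G} (h : ¬ Joined A (ref.src d) (ref.dst d)) :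
    numComponents (insert d.1 A) + 1 = numComponents A := by
  let r (S : SpanningSubgraph G) : V(G) → V(G) → Prop :=
    fun x y => ∃ e ∈ S, G.IsLink (e : β) (x : α) (y : α)
  have : DecidableEq (Quot (r A)) := Classical.decEq _
  let f : Quot (r A) → Quot (r (insert d.1 A)) :=
    Quot.map id fun x y ⟨e, he, hl⟩ => ⟨e, Finset.mem_insert_of_mem he, hl⟩
  let q : Quot (r A) := Quot.mk _ (ref.src d)
  -- The merged component is represented by the old component of `ref.dst d`, which makes this a
  -- left inverse of `f` away from `q`.
  let g : Quot (r (insert d.1 A)) → Quot (r A) :=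
    Quot.lift (fun x => if Quot.mk (r A) x = q then Quot.mk _ (ref.dst d) else Quot.mk _ x) (by
      have hd : Quot.mk (r A) (ref.dst d) ≠ q := fun h' => h h'.symm
      rintro x y ⟨e, he, hl⟩
      obtain ⟨s, rfl, rfl⟩ := ref.exists_of_isLink hl
      rcases Finset.mem_insert.1 he with rfl | he
      · rcases SignedEdge.eq_or_eq_rev (d := d) (g := (d.1, s)) rfl with h' | h'
        · rw [h', if_pos rfl, if_neg hd]
        · rw [h', RefOrientation.src_rev, RefOrientation.dst_rev, if_pos rfl, if_neg hd]
      · rw [show Quot.mk (r A) (ref.src (e, s)) = Quot.mk (r A) (ref.dst (e, s)) from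
          Joined.of_mem ref (d := (e, s)) he])
  have hbij : Function.Bijective fun p : ({q}ᶜ : Set (Quot (r A))) => f p := by
    constructor
    · rintro ⟨⟨x⟩, hx⟩ ⟨⟨y⟩, hy⟩ hxy
      have := congrArg g hxy
      simp only [g, f] at this
      exact Subtype.ext (((if_neg hx).symm.trans this).trans (if_neg hy))
    · rintro ⟨x⟩
      by_cases hx : Quot.mk (r A) x = q
      · refine ⟨⟨Quot.mk _ (ref.dst d), fun h' => h h'.symm⟩, ?_⟩
        have h1 : f (Quot.mk _ (ref.src d)) = f (Quot.mk _ (ref.dst d)) :=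
          Joined.of_mem ref (Finset.mem_insert_self d.1 A)
        exact h1.symm.trans (congrArg f hx.symm)
      · exact ⟨⟨Quot.mk _ x, hx⟩, rfl⟩
  have h1 := Nat.card_eq_of_bijective _ hbij
  have h2 := Set.ncard_add_ncard_compl ({q} : Set (Quot (r A)))
  rw [Set.ncard_singleton, ← Nat.card_coe_set_eq, h1, add_comm] at h2
  exact h2

variable [Finite V(G)] [Fintype E(G)] {ref : RefOrientation G}

theorem not_joined_iff {A : SpanningSubgraph G} {d : SignedEdge G} :
    ¬ Joined A (ref.src d) (ref.dst d) ↔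
      ∃ D, IsDirectedCut ref D ∧ d ∈ D ∧ Disjoint (edges D) A := by
  constructor
  · intro h
    have hout : d ∈ outEdges ref {y | Joined A (ref.src d) y} :=
      mem_outEdges.2 ⟨show Joined A (ref.src d) (ref.src d) from rfl, h⟩
    obtain ⟨D, hD, hdD, hDout⟩ := exists_isDirectedCut_subset hout
    refine ⟨D, hD, hdD, Finset.disjoint_left.2 fun e he heA => ?_⟩
    obtain ⟨g, hg, rfl⟩ := mem_edges.1 he
    obtain ⟨h1, h2⟩ := mem_outEdges.1 (hDout hg)
    exact h2 (Eq.trans h1 (Joined.of_mem ref heA))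
  · rintro ⟨D, hD, hdD, hDA⟩ h
    obtain ⟨X, rfl⟩ := hD.exists_eq
    obtain ⟨h1, h2⟩ := mem_outEdges.1 hdD
    refine h2 ((h.mem_iff ref fun g hg hs => ?_).1 h1)
    by_contra hd
    exact Finset.disjoint_left.1 hDA (mem_edges.2 ⟨g, mem_outEdges.2 ⟨hs, hd⟩, rfl⟩) hg

theorem joined_iff {A : SpanningSubgraph G} {d : SignedEdge G} (hd : d.1 ∉ A) :
    Joined A (ref.src d) (ref.dst d) ↔
      ∃ D, IsDirectedCycle ref D ∧ d ∈ D ∧ edges D ⊆ insert d.1 A := by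
  constructor
  · intro h
    rcases exists_isDirectedCycle_or_isDirectedCut ref {g | g.1 ∈ A} d with
      ⟨D, hD, hdD, hDA⟩ | ⟨D, hD, hdD, hDA⟩
    · refine ⟨D, hD, hdD, fun e he => ?_⟩
      obtain ⟨g, hg, rfl⟩ := mem_edges.1 he
      rw [Finset.mem_insert]
      exact or_iff_not_imp_left.2 (hDA g hg)
    · refine absurd h (not_joined_iff.2 ⟨D, hD, hdD, Finset.disjoint_left.2 fun e he heA => ?_⟩)
      obtain ⟨g, hg, rfl⟩ := mem_edges.1 he
      exact hDA g hg (fun h => hd (h ▸ heA)) heA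
  · rintro ⟨D, hD, hdD, hDA⟩
    by_contra h
    obtain ⟨D', hD', hdD', hDA'⟩ := not_joined_iff.1 h
    obtain ⟨g, hg, hg'⟩ := hD'.exists_rev_mem hD hdD' hdD
    rcases Finset.mem_insert.1 (hDA (mem_edges.2 ⟨_, hg', rfl⟩)) with h | h
    · rcases SignedEdge.eq_or_eq_rev h with h | h
      · exact hD'.rev_notMem hdD' (by rwa [← h, SignedEdge.rev_rev])
      · rw [SignedEdge.rev_eq_iff, SignedEdge.rev_rev] at h
        exact hD.rev_notMem hdD (h ▸ hg')
    · exact Finset.disjoint_left.1 hDA' (mem_edges.2 ⟨g, hg, rfl⟩) h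

theorem mem_cutActive_iff_not_joined {S U : SpanningSubgraph G} {d : SignedEdge G} (hd : d.1 ∉ S)
    (hU : ∀ f, f ∈ U ↔ f < d.1) :
    d.1 ∈ cutActive S ↔ ¬ Joined (S ∪ U) (ref.src d) (ref.dst d) := by
  rw [mem_cutActive, not_joined_iff, Finset.erase_eq_of_notMem hd]
  constructor
  · rintro ⟨C, hC, hCS, hdC, hmin⟩
    obtain ⟨D, hD, hdD, rfl⟩ := hC.exists_isDirectedCut (ref := ref) hdC
    exact ⟨D, hD, hdD, Finset.disjoint_union_right.2
      ⟨hCS, Finset.disjoint_left.2 fun f hf hfU => (hmin hf).not_gt ((hU f).1 hfU)⟩⟩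
  · rintro ⟨D, hD, hdD, hDSU⟩
    rw [Finset.disjoint_union_right] at hDSU
    exact ⟨edges D, hD.1, hDSU.1, mem_edges.2 ⟨d, hdD, rfl⟩, fun f hf =>
      not_lt.1 fun hlt => Finset.disjoint_left.1 hDSU.2 hf ((hU f).2 hlt)⟩

theorem mem_cycleActive_iff_joined {S U : SpanningSubgraph G} {d : SignedEdge G} (hd : d.1 ∈ S)
    (hU : ∀ f, f ∈ U ↔ d.1 < f) :
    d.1 ∈ cycleActive S ↔ Joined (S ∩ U) (ref.src d) (ref.dst d) := by
  have hdU : d.1 ∉ S ∩ U := fun h => lt_irrefl _ ((hU _).1 (Finset.mem_inter.1 h).2)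
  rw [mem_cycleActive, joined_iff hdU, Finset.insert_eq_of_mem hd]
  constructor
  · rintro ⟨C, hC, hCS, hdC, hmin⟩
    obtain ⟨D, hD, hdD, rfl⟩ := hC.exists_isDirectedCycle (ref := ref) hdC
    refine ⟨D, hD, hdD, fun f hf => ?_⟩
    rw [Finset.mem_insert, Finset.mem_inter, hU]
    exact (hmin hf).eq_or_lt.imp Eq.symm fun h => ⟨hCS hf, h⟩
  · rintro ⟨D, hD, hdD, hDSU⟩
    refine ⟨edges D, hD.1, fun f hf => ?_, mem_edges.2 ⟨d, hdD, rfl⟩, fun f hf => ?_⟩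
    · rcases Finset.mem_insert.1 (hDSU hf) with rfl | h
      · exact hd
      · exact (Finset.mem_inter.1 h).1
    · rcases Finset.mem_insert.1 (hDSU hf) with rfl | h
      · exact le_rfl
      · exact ((hU f).1 (Finset.mem_inter.1 h).2).le

/-- Adding the edges to `S` in increasing order, an edge outside `S` merges two components exactly
if it is the minimum of a cut disjoint from `S`. -/
theorem numComponents_union_add_card (ref : RefOrientation G) (S U : SpanningSubgraph G)
    (hU : ∀ e ∈ U, ∀ f < e, f ∈ U) :
    numComponents (S ∪ U) + (U ∩ (cutActive S \ S)).card = numComponents S := by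
  induction U using Finset.induction_on_max with
  | empty => simp
  | insert e U heU ih =>
    have hmem : ∀ f, f ∈ U ↔ f < e := fun f => ⟨heU f, fun hef =>
      (Finset.mem_insert.1 (hU e (Finset.mem_insert_self e U) f hef)).resolve_left hef.ne⟩
    have heU' : e ∉ U := fun h => lt_irrefl e (heU e h)
    rw [← ih fun a ha b hab => (hmem b).2 (hab.trans ((hmem a).1 ha)), Finset.union_insert]
    by_cases heS : e ∈ S
    · rw [Finset.insert_eq_of_mem (Finset.mem_union_left _ heS),
        Finset.insert_inter_of_notMem fun h => (Finset.mem_sdiff.1 h).2 heS]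
    · have h := mem_cutActive_iff_not_joined (ref := ref) (d := (e, true)) heS hmem
      by_cases he : e ∈ cutActive S
      · rw [← numComponents_insert_of_not_joined ref (h.1 he),
          Finset.insert_inter_of_mem (Finset.mem_sdiff.2 ⟨he, heS⟩),
          Finset.card_insert_of_notMem fun h => heU' (Finset.mem_inter.1 h).1]
        ring
      · rw [numComponents_insert_of_joined ref (not_not.1 fun hj => he (h.2 hj)),
          Finset.insert_inter_of_notMem fun h' => he (Finset.mem_sdiff.1 h').1]

/-- Building `S` up in decreasing order, an edge fails to merge two components exactly if it is the
minimum of a cycle in `S`. -/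
theorem card_add_numComponents_inter (ref : RefOrientation G) (S U : SpanningSubgraph G)
    (hU : ∀ e ∈ U, ∀ f > e, f ∈ U) :
    (S ∩ U).card + numComponents (S ∩ U) =
      Nat.card V(G) + (U ∩ (cycleActive S ∩ S)).card := by
  induction U using Finset.induction_on_min with
  | empty => simp [numComponents_empty]
  | insert e U heU ih =>
    have hmem : ∀ f, f ∈ U ↔ e < f := fun f => ⟨heU f, fun hef =>
      (Finset.mem_insert.1 (hU e (Finset.mem_insert_self e U) f hef)).resolve_left hef.ne'⟩
    have heU' : e ∉ U := fun h => lt_irrefl e (heU e h)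
    have ih := ih fun a ha b hab => (hmem b).2 (((hmem a).1 ha).trans hab)
    by_cases heS : e ∈ S
    · have h := mem_cycleActive_iff_joined (ref := ref) (d := (e, true)) heS hmem
      rw [Finset.inter_insert_of_mem heS,
        Finset.card_insert_of_notMem fun h => heU' (Finset.mem_inter.1 h).2]
      by_cases he : e ∈ cycleActive S
      · rw [numComponents_insert_of_joined ref (h.1 he),
          Finset.insert_inter_of_mem (Finset.mem_inter.2 ⟨he, heS⟩),
          Finset.card_insert_of_notMem fun h => heU' (Finset.mem_inter.1 h).1]
        lia
      · have hn := numComponents_insert_of_not_joined ref fun hj => he (h.2 hj)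
        rw [Finset.insert_inter_of_notMem fun h' => he (Finset.mem_inter.1 h').1, ← ih, ← hn]
        ring
    · rw [Finset.inter_insert_of_notMem heS,
        Finset.insert_inter_of_notMem fun h => heS (Finset.mem_inter.1 h).2, ih]

theorem card_cutActive_sdiff (ref : RefOrientation G) (S : SpanningSubgraph G) :
    numComponents S - numComponents (Finset.univ : SpanningSubgraph G) =
      (cutActive S \ S).card := by
  have h := numComponents_union_add_card ref S Finset.univ fun _ _ f _ => Finset.mem_univ f
  rw [Finset.union_eq_right.2 (Finset.subset_univ S), Finset.univ_inter] at h
  lia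

theorem card_cycleActive_inter (ref : RefOrientation G) (S : SpanningSubgraph G) :
    S.card + numComponents S - Nat.card V(G) = (cycleActive S ∩ S).card := by
  have h := card_add_numComponents_inter ref S Finset.univ fun _ _ f _ => Finset.mem_univ f
  rw [Finset.inter_univ, Finset.univ_inter] at h
  lia

end Counting

/-! ### Expansion of the normal function -/

section Expansion

variable {α β : Type*} {G : Graph α β} [Fintype E(G)] [LinearOrder E(G)]

/-- In the multiplied-out product, `T` is the set of edges that contribute `k₁` or `k₂`; it will
become the set of oriented edges. -/
theorem prod_add_mul_prod_compl_add {R : Type*} [CommRing R] (k₁ k₂ l m : E(G) → R)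
    (S : SpanningSubgraph G) :
    (∏ e ∈ S, (k₁ e + m e)) * ∏ e ∈ Sᶜ, (k₂ e + l e) =
      ∑ T : SpanningSubgraph G, (∏ e ∈ T ∩ S, k₁ e) * (∏ e ∈ T \ S, k₂ e) *
        (∏ e ∈ Tᶜ \ S, l e) * ∏ e ∈ Tᶜ ∩ S, m e := by
  have hite : ∀ (T : SpanningSubgraph G) (f g : E(G) → R),
      ∏ e ∈ T, (if e ∈ S then f e else g e) = (∏ e ∈ T ∩ S, f e) * ∏ e ∈ T \ S, g e := by
    intro T f g
    rw [Finset.prod_ite, Finset.filter_mem_eq_inter, Finset.filter_notMem_eq_sdiff]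
  have h := hite Finset.univ (fun e => k₁ e + m e) (fun e => k₂ e + l e)
  rw [Finset.univ_inter, ← Finset.compl_eq_univ_sdiff] at h
  rw [← h]
  have hsplit : ∀ e, (if e ∈ S then k₁ e + m e else k₂ e + l e) =
      (if e ∈ S then k₁ e else k₂ e) + if e ∈ S then m e else l e := by
    intro e
    split_ifs <;> rfl
  simp only [hsplit]
  rw [Fintype.prod_add]
  refine Finset.sum_congr rfl fun T _ => ?_
  rw [hite, hite]
  ring

variable {ref : RefOrientation G} {σu σb : E(G) → Bool} {φ : Four G → SpanningSubgraph G}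

theorem IsActivityMap.unorientedEdges_eq (h : IsActivityMap ref σu σb φ) (O : Four G) :
    unorientedEdges O = (orientedEdges O)ᶜ \ φ O := by
  ext e
  have h1 : e ∈ unorientedEdges O → e ∉ φ O := fun he =>
    Finset.disjoint_left.1 (h.unoriented_disjoint O) he
  have h2 : e ∈ biorientedEdges O → e ∈ φ O := fun he =>
    h.bioriented_subset O he
  rw [mem_unorientedEdges] at h1
  rw [mem_biorientedEdges] at h2
  rw [Finset.mem_sdiff, Finset.mem_compl, mem_orientedEdges, mem_unorientedEdges]
  clear * - h1 h2
  tauto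

theorem IsActivityMap.biorientedEdges_eq (h : IsActivityMap ref σu σb φ) (O : Four G) :
    biorientedEdges O = (orientedEdges O)ᶜ ∩ φ O := by
  ext e
  have h1 : e ∈ unorientedEdges O → e ∉ φ O := fun he =>
    Finset.disjoint_left.1 (h.unoriented_disjoint O) he
  have h2 : e ∈ biorientedEdges O → e ∈ φ O := fun he =>
    h.bioriented_subset O he
  rw [mem_unorientedEdges] at h1
  rw [mem_biorientedEdges] at h2
  rw [Finset.mem_inter, Finset.mem_compl, mem_orientedEdges, mem_biorientedEdges]
  clear * - h1 h2
  tauto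

/-- Outside `φ O` lie all unoriented edges and the negative cut active ones; bioriented edges and
positive cut active ones lie inside. -/
theorem IsActivityMap.cutActive_inter_eq (h : IsActivityMap ref σu σb φ) (O : Four G) :
    fourCutActive φ O ∩ unorientedEdges O ∪ fourCutActive φ O ∩ negEdges O =
      cutActive (φ O) \ φ O := by
  ext e
  have h1 : e ∈ unorientedEdges O → e ∉ φ O := fun he =>
    Finset.disjoint_left.1 (h.unoriented_disjoint O) he
  have h2 : e ∈ biorientedEdges O → e ∈ φ O := fun he =>
    h.bioriented_subset O he
  have h3 : e ∈ fourCutActive φ O ∩ posEdges O → e ∈ φ O := fun he =>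
    h.cut_pos_subset O he
  have h4 : e ∈ fourCutActive φ O ∩ negEdges O → e ∉ φ O := fun he =>
    Finset.disjoint_left.1 (h.cut_neg_disjoint O) he
  simp only [Finset.mem_union, Finset.mem_inter, Finset.mem_sdiff, fourCutActive,
    mem_unorientedEdges, mem_biorientedEdges, mem_posEdges, mem_negEdges] at *
  clear * - h1 h2 h3 h4
  tauto

theorem IsActivityMap.cycleActive_inter_eq (h : IsActivityMap ref σu σb φ) (O : Four G) :
    fourCycleActive φ O ∩ biorientedEdges O ∪ fourCycleActive φ O ∩ negEdges O =
      cycleActive (φ O) ∩ φ O := by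
  ext e
  have h1 : e ∈ unorientedEdges O → e ∉ φ O := fun he =>
    Finset.disjoint_left.1 (h.unoriented_disjoint O) he
  have h2 : e ∈ biorientedEdges O → e ∈ φ O := fun he =>
    h.bioriented_subset O he
  have h3 : e ∈ fourCycleActive φ O ∩ negEdges O → e ∈ φ O := fun he =>
    h.cycle_neg_subset O he
  have h4 : e ∈ fourCycleActive φ O ∩ posEdges O → e ∉ φ O := fun he =>
    Finset.disjoint_left.1 (h.cycle_pos_disjoint O) he
  simp only [Finset.mem_union, Finset.mem_inter, fourCycleActive,
    mem_unorientedEdges, mem_biorientedEdges, mem_posEdges, mem_negEdges] at *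
  clear * - h1 h2 h3 h4
  tauto

theorem IsActivityMap.normalFunction_eq [Finite V(G)] (h : IsActivityMap ref σu σb φ) {R : Type*}
    [CommRing R] (k₁ k₂ l m : E(G) → R) (w z : R) :
    normalFunction (fun e => k₁ e + m e) (fun e => k₂ e + l e) (1 + w) (1 + z) =
      fourientationSum φ k₁ k₂ l m w z := by
  have hO : fourientationSum φ k₁ k₂ l m w z =
      ∑ p : SpanningSubgraph G × SpanningSubgraph G,
        (∏ e ∈ p.2 ∩ p.1, k₁ e) * (∏ e ∈ p.2 \ p.1, k₂ e) * (∏ e ∈ p.2ᶜ \ p.1, l e) *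
          (∏ e ∈ p.2ᶜ ∩ p.1, m e) * w ^ (cutActive p.1 \ p.1).card *
          z ^ (cycleActive p.1 ∩ p.1).card := by
    -- The sum over pairs is pulled back along `O ↦ (φ O, orientedEdges O)`.
    rw [← h.bijective.sum_comp, fourientationSum]
    refine Finset.sum_congr rfl fun O _ => ?_
    rw [h.cutActive_inter_eq, h.cycleActive_inter_eq, h.unorientedEdges_eq, h.biorientedEdges_eq]
  rw [hO, Fintype.sum_prod_type, normalFunction]
  refine Finset.sum_congr rfl fun S _ => ?_
  rw [card_cutActive_sdiff ref, card_cycleActive_inter ref, prod_add_mul_prod_compl_add,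
    add_sub_cancel_left, add_sub_cancel_left, Finset.sum_mul, Finset.sum_mul]

end Expansion
end Fourientation

theorem mainTheorem3 {α β : Type*} (G : Graph α β) [Finite V(G)] [Fintype E(G)]
    [LinearOrder E(G)] (ref : Fourientation.RefOrientation G) (σu σb : E(G) → Bool) :
    (∃ φ : Fourientation.Four G → Fourientation.SpanningSubgraph G,
      Fourientation.IsActivityMap ref σu σb φ) ∧
    ∀ φ : Fourientation.Four G → Fourientation.SpanningSubgraph G,
      Fourientation.IsActivityMap ref σu σb φ →
      ∀ {R : Type*} [CommRing R] (k₁ k₂ l m : E(G) → R) (w z : R),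
        Fourientation.normalFunction (fun e => k₁ e + m e) (fun e => k₂ e + l e) (1 + w) (1 + z) =
          Fourientation.fourientationSum φ k₁ k₂ l m w z :=
  ⟨Fourientation.exists_isActivityMap ref σu σb,
    fun _ hφ _ _ k₁ k₂ l m w z => hφ.normalFunction_eq k₁ k₂ l m w z⟩
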